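/- Let $d\ge 2$ and let $G$ be a probability measure on $\mathbb R$ such that, for some $b>a>0$ and $\alpha>0$, $G$ is supported on $[a,b]$ and is absolutely continuous with a density $\rho$ satisfying $\rho(x)\ge\alpha$ for almost all $x\in[a,b]$. Consider first-passage percolation on the hypercubic lattice $(\mathbb Z^d,E(\mathbb Z^d))$: the edges $e\in E(\mathbb Z^d)$ carry independent weights $t_e$ with common distribution $G$, a finite path $p$ has passage time $T(p)=\sum_{e\in p}t_e$, the passage time between $u,v\in\mathbb Z^d$ is $T(u,v)=\inf_p T(p)$ over all finite paths $p$ connecting $u$ and $v$, and $\gamma(u,v)$ denotes the geodesic between $u$ and $v$, that is, the almost surely unique path achieving this infimum. Let $\|v\|$ be the $\ell^2$ norm of $v$. Then for every real $\beta\ge1$ there exists $C_\beta>0$, depending only on $d$, $G$ and $\beta$, such that for all $v\in\mathbb Z^d$ with $\|v\|\ge2$, $$\sum_{e\in E(\mathbb Z^d)}\mathbb P(e\in\gamma(0,v))^\beta\le C_\beta\begin{cases}\|v\|^{\left(\frac{d-1}{d+1}\right)\left(\frac{2d}{d-1}-\beta\right)}(\log\|v\|)^{(\beta-1)d} & \text{if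 } 1\le\beta<\frac{2d}{d-1},\\[2pt] (\log\|v\|)^{\frac{d(d+1)}{d-1}+1} & \text{if } \beta=\frac{2d}{d-1},\\[2pt] (\log\|v\|)^{\frac{d(d+1)}{d-1}} & \text{if } \beta>\frac{2d}{d-1}.\end{cases}$$ In particular (the case $\beta=2$), there exists $C>0$, depending only on $d$ and $G$, such that for all $v\in\mathbb Z^d$ with $\|v\|\ge2$, $$\sum_{e\in E(\mathbb Z^d)}\mathbb P(e\in\gamma(0,v))^2\le C\,\|v\|^{\frac{2}{d+1}}(\log\|v\|)^d.$$ -/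

import Mathlib

open MeasureTheory
open scoped ENNReal

namespace FPP

/-- The hypercubic lattice `ℤ^d`: two vertices are adjacent iff their `ℓ¹` distance is `1`. -/
def lattice (d : ℕ) : SimpleGraph (Fin d → ℤ) where
  Adj x y := ∑ i, |x i - y i| = 1
  symm := ⟨fun x y h => by simpa only [abs_sub_comm] using h⟩
  loopless := ⟨fun x h => by simp at h⟩

/-- The edge set `E(ℤ^d)` (unoriented edges), as a type. -/
abbrev Edge (d : ℕ) : Type := (lattice d).edgeSet

/-- The passage time `T(p) = ∑_{e ∈ p} t_e` of a finite lattice path `p` in the environment `t`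
(an edge that is traversed several times is counted with multiplicity). -/
def pathTime {d : ℕ} (t : Edge d → ℝ) {u v : Fin d → ℤ} (p : (lattice d).Walk u v) : ℝ :=
  (p.darts.map fun a => t ⟨a.edge, a.edge_mem⟩).sum

/-- The passage time `T(u,v) = inf_p T(p)` over all finite paths `p` connecting `u` and `v`. -/
noncomputable def passageTime {d : ℕ} (t : Edge d → ℝ) (u v : Fin d → ℤ) : ℝ :=
  ⨅ p : (lattice d).Walk u v, pathTime t p

/-- A geodesic between `u` and `v` is a path achieving the infimum `T(u,v)`. -/
def IsGeodesic {d : ℕ} (t : Edge d → ℝ) {u v : Fin d → ℤ} (p : (lattice d).Walk u v) : Prop :=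
  pathTime t p = passageTime t u v

/-- The set of edges of `γ(u,v)`. For an atomless weight distribution supported in `(0,∞)` there is
almost surely exactly one geodesic between `u` and `v`, so that the set below is the edge set of
that geodesic; on the exceptional null event all geodesics are taken together. -/
def geodesic {d : ℕ} (t : Edge d → ℝ) (u v : Fin d → ℤ) : Set (Edge d) :=
  {e | ∃ p : (lattice d).Walk u v, IsGeodesic t p ∧ (e : Sym2 (Fin d → ℤ)) ∈ p.edges}

/-- The law of the environment: the weights `t_e`, `e ∈ E(ℤ^d)`, are independent with common
distribution `G`. -/
noncomputable def envMeasure (d : ℕ) (G : Measure ℝ) : Measure (Edge d → ℝ) :=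
  Measure.infinitePi fun _ : Edge d => G

/-- The influence `ℙ(e ∈ γ(0,v))`. -/
noncomputable def influence {d : ℕ} (G : Measure ℝ) (v : Fin d → ℤ) (e : Edge d) : ℝ≥0∞ :=
  envMeasure d G {t | e ∈ geodesic t 0 v}

/-- The assumption on the weight distribution: for some `b > a > 0` and `α > 0`, `G` is supported on
`[a,b]` and absolutely continuous with a density `ρ` such that `ρ ≥ α` almost everywhere on
`[a,b]`. -/
def IsAdmissibleWeight (G : Measure ℝ) : Prop :=
  ∃ a b α : ℝ, 0 < a ∧ a < b ∧ 0 < α ∧ G (Set.Icc a b)ᶜ = 0 ∧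
    ∃ ρ : ℝ → ℝ≥0∞, Measurable ρ ∧ G = volume.withDensity ρ ∧
      ∀ᵐ x ∂(volume.restrict (Set.Icc a b)), ENNReal.ofReal α ≤ ρ x

/-- The `ℓ²` norm of a lattice point. -/
noncomputable def norm2 {d : ℕ} (v : Fin d → ℤ) : ℝ :=
  √(∑ i, (v i : ℝ) ^ 2)

end FPP

/-!
The proof is a Mermin–Wagner argument. Because the law of the weights dominates a multiple of
Lebesgue measure on `[a, b]`, there is a bounded score `s` whose pairing `∫ s g dG` is a multiple of
`∫ g` over the top of the interval minus `∫ g` over its bottom. Pairing `s (t e)` with the passage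
time `T (0, v)` therefore gives at least a constant times the probability that `e` lies on the
geodesic and has a weight bounded away from `a`, whereas the scores of distinct edges are
orthogonal.

Let `F` be the difference of `T (0, v)` and the average of `T (x, x + v)` over `x` in a cube of
side `w`. Then `|F| = O(w)`, so by orthogonality the pairings of `F` with the scores of the edges in
a finite set `U` sum to `O(w √|U|)`, while each pairing with the averaged passage time is
`O(w ^ (1 - d))`, as a geodesic spends `O(w)` edges in a ball of radius `w`. If every edge of `U`
has influence at least `ε`, then `w` of order `ε ^ (-1 / (d - 1))` gives
`|U| = O((w / ε) ^ 2) = O(ε ^ (-2 * d / (d - 1)))`.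

The logarithms come from the edges of weight close to `a`, on which the score is of no use: at most
half of the edges of any path in a window of length `R` of order `log ‖v‖` are of this kind, outside
an event of polynomially small probability, so that the influence of an edge is controlled by that
of the high-weight edges nearby. Summing the counting bound over dyadic values of the influence,
together with `∑ P (e ∈ γ) = O(‖v‖)`, yields the three regimes.
-/

namespace FPP

variable {d : ℕ}

/-! ### The lattice -/

/-- The `ℓ¹` norm of a lattice point, which is its graph distance to the origin. -/
def l1 (x : Fin d → ℤ) : ℕ := ∑ i, (x i).natAbs

lemma l1_zero : l1 (0 : Fin d → ℤ) = 0 := by simp [l1]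

lemma l1_neg (x : Fin d → ℤ) : l1 (-x) = l1 x := by simp [l1]

lemma l1_sub_comm (x y : Fin d → ℤ) : l1 (x - y) = l1 (y - x) := by
  rw [← l1_neg, neg_sub]

lemma l1_add_le (x y : Fin d → ℤ) : l1 (x + y) ≤ l1 x + l1 y := by
  simp only [l1, ← Finset.sum_add_distrib]
  exact Finset.sum_le_sum fun i _ => Int.natAbs_add_le _ _

lemma l1_sub_le (x y z : Fin d → ℤ) : l1 (x - z) ≤ l1 (x - y) + l1 (y - z) := by
  simpa using l1_add_le (x - y) (y - z)

lemma l1_eq_zero {x : Fin d → ℤ} : l1 x = 0 ↔ x = 0 := by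
  simp [l1, funext_iff]

lemma natAbs_le_l1 (x : Fin d → ℤ) (i : Fin d) : (x i).natAbs ≤ l1 x :=
  Finset.single_le_sum (f := fun i => (x i).natAbs) (fun _ _ => Nat.zero_le _)
    (Finset.mem_univ i)

lemma lattice_adj_iff {x y : Fin d → ℤ} : (lattice d).Adj x y ↔ l1 (x - y) = 1 := by
  change ∑ i, |x i - y i| = 1 ↔ ∑ i, ((x - y) i).natAbs = 1
  rw [← Nat.cast_inj (R := ℤ)]
  simp

/-- The `2d` unit vectors of the lattice, indexed by a coordinate and a sign. -/
def unitStep (s : Fin d × Bool) : Fin d → ℤ := Pi.single s.1 (if s.2 then 1 else -1)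

lemma l1_unitStep (s : Fin d × Bool) : l1 (unitStep s) = 1 := by
  unfold l1 unitStep
  rw [Finset.sum_eq_single s.1 (fun j _ hj => by simp [hj]) (by simp)]
  cases s.2 <;> simp

lemma exists_l1_sub_unitStep {z : Fin d → ℤ} (hz : z ≠ 0) :
    ∃ s, l1 (z - unitStep s) + 1 = l1 z := by
  obtain ⟨i, hi⟩ := Function.ne_iff.1 hz
  set s : Fin d × Bool := (i, decide (0 < z i)) with hs
  have on_axis : ((z - unitStep s) i).natAbs + 1 = (z i).natAbs := by
    have : z i ≠ 0 := hi
    by_cases hpos : 0 < z i <;> simp [hs, unitStep, hpos] <;> omega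
  have off_axis : ∀ j ∈ Finset.univ.erase i, ((z - unitStep s) j).natAbs = (z j).natAbs :=
    fun j hj => by simp [hs, unitStep, Finset.ne_of_mem_erase hj]
  refine ⟨s, ?_⟩
  unfold l1
  rw [← Finset.add_sum_erase _ _ (Finset.mem_univ i),
    ← Finset.add_sum_erase _ (fun j => (z j).natAbs) (Finset.mem_univ i),
    Finset.sum_congr rfl off_axis]
  omega

lemma lattice_adj_iff_exists_unitStep {x y : Fin d → ℤ} :
    (lattice d).Adj x y ↔ ∃ s, y = x + unitStep s := by
  rw [lattice_adj_iff, l1_sub_comm]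
  constructor
  · intro h
    obtain ⟨s, hs⟩ := exists_l1_sub_unitStep (z := y - x) (by rintro h0; simp [h0, l1_zero] at h)
    have : y - x - unitStep s = 0 := l1_eq_zero.1 (by omega)
    exact ⟨s, by rw [← sub_eq_zero, ← this]; abel⟩
  · rintro ⟨s, rfl⟩
    rw [add_sub_cancel_left, l1_unitStep]

lemma exists_walk_length_eq (x y : Fin d → ℤ) :
    ∃ p : (lattice d).Walk x y, p.length = l1 (y - x) := by
  induction h : l1 (y - x) generalizing x with
  | zero =>
    obtain rfl : y = x := sub_eq_zero.1 (l1_eq_zero.1 h)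
    exact ⟨.nil, rfl⟩
  | succ n ih =>
    obtain ⟨s, hs⟩ := exists_l1_sub_unitStep (z := y - x) (by rintro h0; simp [h0, l1_zero] at h)
    obtain ⟨p, hp⟩ := ih (x + unitStep s) (by rw [← sub_sub]; omega)
    exact ⟨.cons (lattice_adj_iff_exists_unitStep.2 ⟨s, rfl⟩) p, by simp [hp]⟩

instance (u v : Fin d → ℤ) : Nonempty ((lattice d).Walk u v) :=
  ⟨(exists_walk_length_eq u v).choose⟩

lemma l1_getVert_sub_le {u v : Fin d → ℤ} (p : (lattice d).Walk u v) {i j : ℕ} (hij : i ≤ j) :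
    l1 (p.getVert j - p.getVert i) ≤ j - i := by
  induction j, hij using Nat.le_induction with
  | base => simp [l1_zero]
  | succ j hj ih =>
    refine (l1_sub_le _ (p.getVert j) _).trans ?_
    have : l1 (p.getVert (j + 1) - p.getVert j) ≤ 1 := by
      by_cases h : j < p.length
      · rw [l1_sub_comm, lattice_adj_iff.1 (p.adj_getVert_succ h)]
      · rw [p.getVert_of_length_le (by omega), p.getVert_of_length_le (by omega)]
        simp [l1_zero]
    omega

/-- The finite `ℓ¹` ball of radius `n` around `x`. -/
noncomputable def ball (x : Fin d → ℤ) (n : ℕ) : Finset (Fin d → ℤ) :=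
  {y ∈ Finset.Icc (x - fun _ => (n : ℤ)) (x + fun _ => (n : ℤ)) | l1 (y - x) ≤ n}

@[simp] lemma mem_ball {x y : Fin d → ℤ} {n : ℕ} : y ∈ ball x n ↔ l1 (y - x) ≤ n := by
  refine Finset.mem_filter.trans (and_iff_right_of_imp fun h => ?_)
  have coord (i : Fin d) : (y i - x i).natAbs ≤ n := (natAbs_le_l1 (y - x) i).trans h
  refine Finset.mem_Icc.2 ⟨fun i => ?_, fun i => ?_⟩ <;> have := coord i <;> simp <;> omega

lemma card_ball_le (x : Fin d → ℤ) (n : ℕ) : (ball x n).card ≤ (2 * n + 1) ^ d := by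
  refine (Finset.card_filter_le _ _).trans ?_
  rw [Pi.card_Icc]
  simp only [Pi.sub_apply, Pi.add_apply, Int.card_Icc]
  refine (Finset.prod_le_pow_card _ _ (2 * n + 1) fun i _ => ?_).trans (by simp)
  omega

noncomputable instance : (lattice d).LocallyFinite := fun x =>
  ((ball x 1).finite_toSet.subset fun _ hy =>
    mem_ball.2 (lattice_adj_iff.1 ((lattice d).adj_symm hy)).le).fintype

instance (u v : Fin d → ℤ) : Countable ((lattice d).Walk u v) := by
  have : Countable (lattice d).Dart :=
    (SimpleGraph.Dart.toProd_injective (G := lattice d)).countable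
  exact SimpleGraph.Walk.darts_injective.countable

instance : Countable (Sym2 (Fin d → ℤ)) := Quot.mk_surjective.countable

/-! ### Edges of a walk -/

/-- The list of edges of a walk, as elements of the edge set of the lattice. -/
def edgeList {u v : Fin d → ℤ} (p : (lattice d).Walk u v) : List (Edge d) :=
  p.darts.map fun a => ⟨a.edge, a.edge_mem⟩

section edgeList

variable {u v w : Fin d → ℤ}

lemma map_val_edgeList (p : (lattice d).Walk u v) :
    (edgeList p).map Subtype.val = p.edges := by
  simp [edgeList, SimpleGraph.Walk.edges, Function.comp_def]

lemma mem_edgeList {p : (lattice d).Walk u v} {e : Edge d} :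
    e ∈ edgeList p ↔ (e : Sym2 (Fin d → ℤ)) ∈ p.edges := by
  rw [← map_val_edgeList, List.mem_map]
  exact ⟨fun h => ⟨e, h, rfl⟩, fun ⟨e', h, h'⟩ => Subtype.ext h' ▸ h⟩

@[simp] lemma length_edgeList (p : (lattice d).Walk u v) : (edgeList p).length = p.length := by
  simp [edgeList]

@[simp] lemma edgeList_append (p : (lattice d).Walk u v) (q : (lattice d).Walk v w) :
    edgeList (p.append q) = edgeList p ++ edgeList q := by
  simp [edgeList]

lemma edgeList_take (p : (lattice d).Walk u v) (n : ℕ) :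
    edgeList (p.take n) = (edgeList p).take n := by
  simp [edgeList, SimpleGraph.Walk.darts_take, List.map_take]

lemma edgeList_drop (p : (lattice d).Walk u v) (n : ℕ) :
    edgeList (p.drop n) = (edgeList p).drop n := by
  simp [edgeList, SimpleGraph.Walk.darts_drop, List.map_drop]

lemma nodup_edgeList {p : (lattice d).Walk u v} (hp : p.IsPath) : (edgeList p).Nodup := by
  have := hp.isTrail.edges_nodup
  rw [← map_val_edgeList] at this
  exact this.of_map _

lemma val_getElem_edgeList (p : (lattice d).Walk u v) {i : ℕ} (hi : i < (edgeList p).length) :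
    ((edgeList p)[i] : Sym2 (Fin d → ℤ)) = s(p.getVert i, p.getVert (i + 1)) := by
  have hi' : i < p.edges.length := by simpa using hi
  rw [← SimpleGraph.Walk.getElem_edges hi']
  simp [← map_val_edgeList]

end edgeList

/-! ### Passage times and geodesics -/

section pathTime

variable {u v w : Fin d → ℤ} {t : Edge d → ℝ}

lemma pathTime_eq_sum (t : Edge d → ℝ) (p : (lattice d).Walk u v) :
    pathTime t p = ((edgeList p).map t).sum := by
  simp [pathTime, edgeList, Function.comp_def]

lemma pathTime_append (t : Edge d → ℝ) (p : (lattice d).Walk u v) (q : (lattice d).Walk v w) :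
    pathTime t (p.append q) = pathTime t p + pathTime t q := by
  simp [pathTime_eq_sum]

lemma pathTime_take_add_drop (t : Edge d → ℝ) (p : (lattice d).Walk u v) (n : ℕ) :
    pathTime t (p.take n) + pathTime t (p.drop n) = pathTime t p := by
  rw [pathTime_eq_sum, pathTime_eq_sum, pathTime_eq_sum, edgeList_take, edgeList_drop,
    ← List.sum_append, ← List.map_append, List.take_append_drop]

lemma pathTime_mono {t t' : Edge d → ℝ} (h : ∀ e, t e ≤ t' e) (p : (lattice d).Walk u v) :
    pathTime t p ≤ pathTime t' p := by
  rw [pathTime_eq_sum, pathTime_eq_sum]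
  exact List.sum_le_sum fun e _ => h e

lemma pathTime_const (c : ℝ) (p : (lattice d).Walk u v) :
    pathTime (fun _ => c) p = c * p.length := by
  simp [pathTime_eq_sum, mul_comm]

lemma mul_length_le_pathTime {a : ℝ} (ht : ∀ e, a ≤ t e) (p : (lattice d).Walk u v) :
    a * p.length ≤ pathTime t p :=
  pathTime_const a p ▸ pathTime_mono ht p

lemma pathTime_nonneg (ht : ∀ e, 0 ≤ t e) (p : (lattice d).Walk u v) : 0 ≤ pathTime t p := by
  simpa using mul_length_le_pathTime ht p

lemma pathTime_update (t : Edge d → ℝ) (e : Edge d) (s : ℝ) (p : (lattice d).Walk u v) :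
    pathTime (Function.update t e s) p =
      pathTime t p + (edgeList p).count e * (s - t e) := by
  rw [pathTime_eq_sum, pathTime_eq_sum]
  induction edgeList p with
  | nil => simp
  | cons e' l ih =>
    rw [List.map_cons, List.map_cons, List.sum_cons, List.sum_cons, ih]
    by_cases h : e' = e
    · subst h
      simp only [Function.update_self, List.count_cons_self]
      push_cast
      ring
    · rw [Function.update_of_ne h, List.count_cons_of_ne h]
      ring

lemma pathTime_bypass_le (ht : ∀ e, 0 ≤ t e) (p : (lattice d).Walk u v) :
    pathTime t p.bypass ≤ pathTime t p := by
  refine List.Sublist.sum_le_sum (p.darts_bypass_sublist_darts.map _) fun x hx => ?_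
  obtain ⟨a, -, rfl⟩ := List.mem_map.1 hx
  exact ht _

end pathTime

section passageTime

variable {u v : Fin d → ℤ} {t : Edge d → ℝ}

lemma passageTime_le (ht : ∀ e, 0 ≤ t e) (p : (lattice d).Walk u v) :
    passageTime t u v ≤ pathTime t p :=
  ciInf_le ⟨0, Set.forall_mem_range.2 (pathTime_nonneg ht)⟩ p

lemma passageTime_nonneg (ht : ∀ e, 0 ≤ t e) (u v : Fin d → ℤ) : 0 ≤ passageTime t u v :=
  le_ciInf (pathTime_nonneg ht)

lemma passageTime_mono {t' : Edge d → ℝ} (ht : ∀ e, 0 ≤ t e) (h : ∀ e, t e ≤ t' e)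
    (u v : Fin d → ℤ) : passageTime t u v ≤ passageTime t' u v :=
  le_ciInf fun p => (passageTime_le ht p).trans (pathTime_mono h p)

lemma passageTime_le_mul_l1 {b : ℝ} (ht : ∀ e, t e ∈ Set.Icc 0 b) (u v : Fin d → ℤ) :
    passageTime t u v ≤ b * l1 (v - u) := by
  obtain ⟨p, hp⟩ := exists_walk_length_eq u v
  calc passageTime t u v ≤ pathTime t p := passageTime_le (fun e => (ht e).1) p
    _ ≤ pathTime (fun _ => b) p := pathTime_mono (fun e => (ht e).2) p
    _ = b * l1 (v - u) := by rw [pathTime_const, hp]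

lemma passageTime_triangle (ht : ∀ e, 0 ≤ t e) (x y z : Fin d → ℤ) :
    passageTime t x z ≤ passageTime t x y + passageTime t y z :=
  le_ciInf_add_ciInf fun p q => pathTime_append t p q ▸ passageTime_le ht (p.append q)

lemma abs_passageTime_sub_le {b : ℝ} (ht : ∀ e, t e ∈ Set.Icc 0 b) (x x' y y' : Fin d → ℤ) :
    |passageTime t x y - passageTime t x' y'| ≤ b * l1 (x - x') + b * l1 (y - y') := by
  have one_sided (x x' y y' : Fin d → ℤ) :
      passageTime t x y ≤ passageTime t x' y' + (b * l1 (x - x') + b * l1 (y - y')) := by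
    have left := passageTime_triangle (fun e => (ht e).1) x x' y
    have right := passageTime_triangle (fun e => (ht e).1) x' y' y
    have hx := passageTime_le_mul_l1 ht x x'
    have hy := passageTime_le_mul_l1 ht y' y
    rw [l1_sub_comm] at hx
    linarith
  have h := one_sided x x' y y'
  have h' := one_sided x' x y' y
  rw [l1_sub_comm x' x, l1_sub_comm y' y] at h'
  rw [abs_sub_le_iff]
  constructor <;> linarith

/-- A minimum over the finitely many walks that are not too long to compete. -/
lemma exists_isGeodesic {a : ℝ} (ha : 0 < a) (ht : ∀ e, a ≤ t e) (u v : Fin d → ℤ) :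
    ∃ p : (lattice d).Walk u v, IsGeodesic t p := by
  obtain ⟨p₀⟩ : Nonempty ((lattice d).Walk u v) := inferInstance
  obtain ⟨n, hn⟩ := exists_nat_gt (pathTime t p₀ / a)
  rw [div_lt_iff₀ ha] at hn
  have short (p : (lattice d).Walk u v) (hp : pathTime t p ≤ pathTime t p₀) : p.length < n := by
    have : a * p.length < a * n := by linarith [mul_length_le_pathTime ht p]
    exact_mod_cast lt_of_mul_lt_mul_left this ha.le
  obtain ⟨p, -, hmin⟩ := Set.exists_min_image {p : (lattice d).Walk u v | p.length < n}
    (pathTime t) (Set.toFinite _) ⟨p₀, short p₀ le_rfl⟩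
  refine ⟨p, le_antisymm (le_ciInf fun q => ?_) (passageTime_le (fun e => ha.le.trans (ht e)) p)⟩
  rcases le_total (pathTime t q) (pathTime t p₀) with hq | hq
  · exact hmin q (short q hq)
  · exact (hmin p₀ (short p₀ le_rfl)).trans hq

lemma exists_isGeodesic_isPath {a : ℝ} (ha : 0 < a) (ht : ∀ e, a ≤ t e) (u v : Fin d → ℤ) :
    ∃ p : (lattice d).Walk u v, IsGeodesic t p ∧ p.IsPath := by
  have ht0 (e) : 0 ≤ t e := ha.le.trans (ht e)
  obtain ⟨p, hp⟩ := exists_isGeodesic ha ht u v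
  exact ⟨p.bypass, le_antisymm (hp ▸ pathTime_bypass_le ht0 p) (passageTime_le ht0 _),
    p.bypass_isPath⟩

lemma mem_geodesic {e : Edge d} :
    e ∈ geodesic t u v ↔ ∃ p : (lattice d).Walk u v, IsGeodesic t p ∧ e ∈ edgeList p := by
  simp [geodesic, mem_edgeList]

lemma IsGeodesic.take (ht : ∀ e, 0 ≤ t e) {p : (lattice d).Walk u v} (hp : IsGeodesic t p)
    (n : ℕ) : IsGeodesic t (p.take n) := by
  have := passageTime_triangle ht u (p.getVert n) v
  have := pathTime_take_add_drop t p n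
  have := passageTime_le ht (p.drop n)
  refine le_antisymm ?_ (passageTime_le ht _)
  linarith [hp.le]

lemma IsGeodesic.drop (ht : ∀ e, 0 ≤ t e) {p : (lattice d).Walk u v} (hp : IsGeodesic t p)
    (n : ℕ) : IsGeodesic t (p.drop n) := by
  have := passageTime_triangle ht u (p.getVert n) v
  have := pathTime_take_add_drop t p n
  have := passageTime_le ht (p.take n)
  refine le_antisymm ?_ (passageTime_le ht _)
  linarith [hp.le]

lemma IsGeodesic.length_le {a b : ℝ} (ha : 0 < a) (ht : ∀ e, t e ∈ Set.Icc a b)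
    {p : (lattice d).Walk u v} (hp : IsGeodesic t p) : (p.length : ℝ) ≤ b / a * l1 (v - u) := by
  have := calc a * p.length ≤ pathTime t p := mul_length_le_pathTime (fun e => (ht e).1) p
    _ = passageTime t u v := hp
    _ ≤ b * l1 (v - u) := passageTime_le_mul_l1 (fun e => ⟨ha.le.trans (ht e).1, (ht e).2⟩) u v
  rw [div_mul_eq_mul_div, le_div_iff₀ ha]
  linarith

end passageTime

section update

variable {u v : Fin d → ℤ} {t : Edge d → ℝ} {e : Edge d} {s : ℝ}

lemma update_mem {I : Set ℝ} (ht : ∀ e, t e ∈ I) (e : Edge d) (hs : s ∈ I) (e' : Edge d) :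
    Function.update t e s e' ∈ I :=
  (Function.forall_update_iff t fun _ x => x ∈ I).2 ⟨hs, fun e _ => ht e⟩ e'

lemma IsGeodesic.passageTime_update_le (ht : ∀ e, 0 ≤ t e) (hs : 0 ≤ s)
    {p : (lattice d).Walk u v} (hp : IsGeodesic t p) (e : Edge d) :
    passageTime (Function.update t e s) u v ≤
      passageTime t u v + (edgeList p).count e * (s - t e) := by
  rw [← hp, ← pathTime_update]
  exact passageTime_le (update_mem (I := Set.Ici 0) ht e hs) p

lemma passageTime_update_le_add {a : ℝ} (ha : 0 < a) (ht : ∀ e, a ≤ t e) (u v : Fin d → ℤ)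
    (hs : t e ≤ s) :
    passageTime (Function.update t e s) u v ≤ passageTime t u v + (s - t e) := by
  obtain ⟨p, hp, hpath⟩ := exists_isGeodesic_isPath ha ht u v
  have hcount : ((edgeList p).count e : ℝ) ≤ 1 :=
    mod_cast List.nodup_iff_count_le_one.1 (nodup_edgeList hpath) e
  have ht0 (e) : 0 ≤ t e := ha.le.trans (ht e)
  have := hp.passageTime_update_le ht0 ((ht0 e).trans hs) e
  nlinarith

lemma passageTime_update_le_of_notMem {a : ℝ} (ha : 0 < a) (ht : ∀ e, a ≤ t e)
    (he : e ∉ geodesic t u v) (hs : 0 ≤ s) :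
    passageTime (Function.update t e s) u v ≤ passageTime t u v := by
  obtain ⟨p, hp⟩ := exists_isGeodesic ha ht u v
  have hcount : (edgeList p).count e = 0 :=
    List.count_eq_zero.2 fun h => he (mem_geodesic.2 ⟨p, hp, h⟩)
  simpa [hcount] using hp.passageTime_update_le (fun e => ha.le.trans (ht e)) hs e

lemma passageTime_update_le_sub (ht : ∀ e, 0 ≤ t e) (he : e ∈ geodesic t u v) (hs0 : 0 ≤ s)
    (hs : s ≤ t e) :
    passageTime (Function.update t e s) u v ≤ passageTime t u v - (t e - s) := by
  obtain ⟨p, hp, hep⟩ := mem_geodesic.1 he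
  have hcount : (1 : ℝ) ≤ (edgeList p).count e := mod_cast List.one_le_count_iff.2 hep
  have := hp.passageTime_update_le ht hs0 e
  nlinarith

lemma add_min_le_passageTime_update {a : ℝ} (ha : 0 < a) (ht : ∀ e, a ≤ t e)
    (he : e ∈ geodesic t u v) {s' : ℝ} (has : a ≤ s) (hs : s ≤ t e) (hss' : s ≤ s') :
    passageTime (Function.update t e s) u v + min (t e - s) (s' - s) ≤
      passageTime (Function.update t e s') u v := by
  have ht0 (e) : 0 ≤ t e := ha.le.trans (ht e)
  have lowered := passageTime_update_le_sub ht0 he (ha.le.trans has) hs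
  rcases le_total (t e) s' with h | h
  · have raised : passageTime t u v ≤ passageTime (Function.update t e s') u v :=
      passageTime_mono ht0 (le_update_iff.2 ⟨h, fun _ _ => le_rfl⟩) u v
    linarith [min_le_left (t e - s) (s' - s)]
  · have raised := passageTime_update_le_add ha
      (update_mem (I := Set.Ici a) ht e (has.trans hss')) u v (e := e) (s := t e) (by simpa using h)
    simp only [Function.update_idem, Function.update_eq_self, Function.update_self] at raised
    linarith [min_le_right (t e - s) (s' - s)]

end update

/-! ### Edges near a point, and low edges along a path -/

/-- The edge from `x` in direction `s`. -/
def stepEdge (x : Fin d → ℤ) (s : Fin d × Bool) : Edge d :=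
  ⟨s(x, x + unitStep s), lattice_adj_iff_exists_unitStep.2 ⟨s, rfl⟩⟩

/-- The finite set of edges with an endpoint in the `ℓ¹` ball of radius `n` around `z`. -/
noncomputable def edgeBall (z : Fin d → ℤ) (n : ℕ) : Finset (Edge d) :=
  (ball z n ×ˢ Finset.univ).image fun q => stepEdge q.1 q.2

lemma mem_edgeBall {e : Edge d} {z : Fin d → ℤ} {n : ℕ} :
    e ∈ edgeBall z n ↔ ∃ x ∈ (e : Sym2 (Fin d → ℤ)), l1 (x - z) ≤ n := by
  simp only [edgeBall, Finset.mem_image, Finset.mem_product, mem_ball, Finset.mem_univ, and_true]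
  constructor
  · rintro ⟨⟨x, s⟩, hx, rfl⟩
    exact ⟨x, Sym2.mem_mk_left _ _, hx⟩
  · obtain ⟨e, he⟩ := e
    rintro ⟨x, ⟨y, rfl⟩, hx⟩
    obtain ⟨s, hs : y = x + unitStep s⟩ := lattice_adj_iff_exists_unitStep.1 he
    exact ⟨(x, s), hx, by subst hs; rfl⟩

lemma card_edgeBall_le (z : Fin d → ℤ) (n : ℕ) :
    (edgeBall z n).card ≤ (2 * n + 1) ^ d * (2 * d) := by
  refine Finset.card_image_le.trans ?_
  rw [Finset.card_product]
  refine Nat.mul_le_mul (card_ball_le z n) ?_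
  simp [mul_comm]

/-- A distinguished endpoint of an edge. -/
noncomputable def Edge.base (e : Edge d) : Fin d → ℤ := (Quot.out (e : Sym2 (Fin d → ℤ))).1

lemma Edge.base_mem (e : Edge d) : e.base ∈ (e : Sym2 (Fin d → ℤ)) := Sym2.out_fst_mem _

/-- The edges within distance `n` of a finite set of edges. -/
noncomputable def thickening (E : Finset (Edge d)) (n : ℕ) : Finset (Edge d) :=
  E.biUnion fun e => edgeBall e.base n

lemma card_thickening_le (E : Finset (Edge d)) (n : ℕ) :
    (thickening E n).card ≤ E.card * ((2 * n + 1) ^ d * (2 * d)) :=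
  Finset.card_biUnion_le_card_mul _ _ _ fun _ _ => card_edgeBall_le _ _

section walks

variable {u v : Fin d → ℤ}

lemma mem_thickening_of_mem_edgeList (p : (lattice d).Walk u v) {e e' : Edge d}
    {E : Finset (Edge d)} (he : e ∈ edgeList p) (heE : e ∈ E) (he' : e' ∈ edgeList p) :
    e' ∈ thickening E p.length := by
  obtain ⟨i, hi, rfl⟩ := List.getElem_of_mem he
  obtain ⟨j, hj, rfl⟩ := List.getElem_of_mem he'
  refine Finset.mem_biUnion.2 ⟨_, heE, mem_edgeBall.2 ⟨p.getVert j, ?_, ?_⟩⟩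
  · rw [val_getElem_edgeList]
    exact Sym2.mem_mk_left _ _
  rw [length_edgeList] at hi hj
  have close (k) (hk : k ≤ p.length) : l1 (p.getVert j - p.getVert k) ≤ p.length := by
    rcases le_total k j with h | h
    · exact (l1_getVert_sub_le p h).trans (by omega)
    · exact l1_sub_comm (p.getVert j) _ ▸ (l1_getVert_sub_le p h).trans (by omega)
  have base_mem := (edgeList p)[i].base_mem
  rw [val_getElem_edgeList, Sym2.mem_iff] at base_mem
  rcases base_mem with h | h <;> rw [h] <;> exact close _ (by omega)

lemma card_le_of_forall_sub_le {I : Finset ℕ} {K : ℝ} (hK : 0 ≤ K)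
    (hI : ∀ i ∈ I, ∀ j ∈ I, i ≤ j → ((j - i : ℕ) : ℝ) ≤ K) : (I.card : ℝ) ≤ K + 1 := by
  rcases I.eq_empty_or_nonempty with rfl | h
  · simpa using by positivity
  have hsub : I ⊆ Finset.Icc (I.min' h) (I.max' h) := fun i hi =>
    Finset.mem_Icc.2 ⟨I.min'_le i hi, I.le_max' i hi⟩
  have hcard : I.card ≤ (I.max' h - I.min' h) + 1 := by
    have := Finset.card_le_card hsub
    rw [Nat.card_Icc] at this
    omega
  have hdiam := hI _ (I.min'_mem h) _ (I.max'_mem h) (I.min'_le_max' h)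
  calc (I.card : ℝ) ≤ (I.max' h - I.min' h : ℕ) + 1 := mod_cast hcard
    _ ≤ K + 1 := by gcongr

lemma l1_getVert_idxOf_sub_le {p : (lattice d).Walk u v} {e : Edge d} (hep : e ∈ edgeList p)
    {z : Fin d → ℤ} {n : ℕ} (hez : e ∈ edgeBall z n) :
    l1 (p.getVert ((edgeList p).idxOf e) - z) ≤ n + 1 := by
  obtain ⟨x, hx, hxz⟩ := mem_edgeBall.1 hez
  set i := (edgeList p).idxOf e with hi
  have hval := val_getElem_edgeList p (List.idxOf_lt_length_of_mem hep)
  rw [List.getElem_idxOf, ← hi] at hval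
  rw [hval, Sym2.mem_iff] at hx
  rcases hx with rfl | rfl
  · omega
  · have hstep := l1_getVert_sub_le p i.le_succ
    rw [l1_sub_comm, Nat.succ_eq_add_one] at hstep
    have := l1_sub_le (p.getVert i) (p.getVert (i + 1)) z
    omega

lemma IsGeodesic.sub_le {t : Edge d → ℝ} {a b : ℝ} (ha : 0 < a) (ht : ∀ e, t e ∈ Set.Icc a b)
    {p : (lattice d).Walk u v} (hp : IsGeodesic t p) {i j : ℕ} (hij : i ≤ j)
    (hj : j ≤ p.length) :
    ((j - i : ℕ) : ℝ) ≤ b / a * l1 (p.getVert j - p.getVert i) := by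
  have ht0 (e) : 0 ≤ t e := ha.le.trans (ht e).1
  have h := ((hp.drop ht0 i).take ht0 (j - i)).length_le ha ht
  have hlen : ((p.drop i).take (j - i)).length = j - i := by simp; omega
  rwa [hlen, SimpleGraph.Walk.drop_getVert, Nat.add_sub_cancel' hij] at h

/-- Two passages through a ball of radius `n` are at distance at most `2n`, and a geodesic spends
at most proportional time between them. -/
lemma IsGeodesic.card_edgeBall_filter_le {t : Edge d → ℝ} {a b : ℝ} (ha : 0 < a) (hab : a ≤ b)
    (ht : ∀ e, t e ∈ Set.Icc a b) {p : (lattice d).Walk u v} (hp : IsGeodesic t p)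
    (z : Fin d → ℤ) (n : ℕ) :
    (((edgeBall z n).filter (· ∈ edgeList p)).card : ℝ) ≤ b / a * (2 * (n + 1)) + 1 := by
  have hba : 0 ≤ b / a := div_nonneg (ha.le.trans hab) ha.le
  set I := (Finset.range p.length).filter fun i => l1 (p.getVert i - z) ≤ n + 1 with hI
  have hcard : ((edgeBall z n).filter (· ∈ edgeList p)).card ≤ I.card := by
    refine Finset.card_le_card_of_injOn (fun e => (edgeList p).idxOf e) (fun e he => ?_)
      fun e he e' _ h => (List.idxOf_inj (Finset.mem_filter.1 he).2).1 h
    obtain ⟨hez, hep⟩ := Finset.mem_filter.1 he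
    have hlt := List.idxOf_lt_length_of_mem hep
    rw [length_edgeList] at hlt
    simpa [hI, hlt] using l1_getVert_idxOf_sub_le hep hez
  refine le_trans (mod_cast hcard)
    (card_le_of_forall_sub_le (by positivity) fun i hi j hj hij => ?_)
  obtain ⟨-, hiz⟩ := Finset.mem_filter.1 hi
  obtain ⟨hjp, hjz⟩ := Finset.mem_filter.1 hj
  have hdist : l1 (p.getVert j - p.getVert i) ≤ 2 * (n + 1) := by
    have := l1_sub_le (p.getVert j) z (p.getVert i)
    rw [l1_sub_comm z] at this
    omega
  refine (hp.sub_le ha ht hij (Finset.mem_range.1 hjp).le).trans ?_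
  gcongr
  exact_mod_cast hdist

end walks

/-- If one predicate is at most twice as frequent as another in every window of length `R`, then it
is at most four times as frequent in the whole list: the windows tile all of the list but its last
window. -/
lemma countP_le_four_mul {α : Type*} {P Q : α → Bool} {R : ℕ} (hR : 0 < R) (l : List α)
    (hl : R ≤ l.length)
    (h : ∀ k, k + R ≤ l.length →
      ((l.drop k).take R).countP P ≤ 2 * ((l.drop k).take R).countP Q) :
    l.countP P ≤ 4 * l.countP Q := by
  have tiled (m : ℕ) (hm : m * R ≤ l.length) :
      (l.take (m * R)).countP P ≤ 2 * (l.take (m * R)).countP Q := by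
    induction m with
    | zero => simp
    | succ m ih =>
      rw [Nat.succ_mul] at hm ⊢
      rw [List.take_add, List.countP_append, List.countP_append]
      have := ih (by omega)
      have := h _ hm
      omega
  set k := l.length / R * R
  have hk_le : k ≤ l.length := Nat.div_mul_le_self _ _
  have hk_lt : l.length < k + R := Nat.lt_div_mul_add hR
  have last := h (l.length - R) (by omega)
  rw [List.take_of_length_le (by simp; omega)] at last
  calc l.countP P = (l.take k).countP P + (l.drop k).countP P := by
        rw [← List.countP_append, List.take_append_drop]
    _ ≤ (l.take k).countP P + (l.drop (l.length - R)).countP P := by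
        gcongr
        exact (List.drop_sublist_drop_left l (by omega)).countP_le
    _ ≤ 2 * (l.take k).countP Q + 2 * (l.drop (l.length - R)).countP Q :=
        add_le_add (tiled _ hk_le) last
    _ ≤ 2 * l.countP Q + 2 * l.countP Q := by
        gcongr
        · exact (List.take_sublist _ _).countP_le
        · exact (List.drop_sublist _ _).countP_le
    _ = 4 * l.countP Q := by ring

lemma card_eq_countP_of_nodup {α : Type*} {l : List α} (hl : l.Nodup) {P : α → Prop}
    [DecidablePred P] {S : Finset α} (hS : ∀ x, x ∈ S ↔ x ∈ l ∧ P x) :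
    S.card = l.countP (P ·) := by
  classical
  rw [List.countP_eq_length_filter, ← List.toFinset_card_of_nodup (hl.filter _)]
  congr 1
  ext x
  simp [hS]

section paths

/-- The edge lists of the walks of length `n` from `x`. -/
noncomputable def walkLists : ℕ → (Fin d → ℤ) → Finset (List (Edge d))
  | 0, _ => {[]}
  | n + 1, x => Finset.univ.biUnion fun s : Fin d × Bool =>
      (walkLists n (x + unitStep s)).image (List.cons (stepEdge x s))

lemma card_walkLists_le (n : ℕ) (x : Fin d → ℤ) : (walkLists n x).card ≤ (2 * d) ^ n := by
  induction n generalizing x with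
  | zero => simp [walkLists]
  | succ n ih =>
    refine (Finset.card_biUnion_le_card_mul _ _ ((2 * d) ^ n) fun s _ =>
      Finset.card_image_le.trans (ih _)).trans (le_of_eq ?_)
    simp only [Finset.card_univ, Fintype.card_prod, Fintype.card_fin, Fintype.card_bool]
    ring

lemma edgeList_mem_walkLists {u v : Fin d → ℤ} (p : (lattice d).Walk u v) :
    edgeList p ∈ walkLists p.length u := by
  induction p with
  | nil => simp [walkLists, edgeList]
  | cons h p ih =>
    obtain ⟨s, rfl⟩ := lattice_adj_iff_exists_unitStep.1 h
    exact Finset.mem_biUnion.2 ⟨s, Finset.mem_univ s, Finset.mem_image.2 ⟨_, ih, rfl⟩⟩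

lemma length_of_mem_walkLists {n : ℕ} {x : Fin d → ℤ} {l : List (Edge d)}
    (h : l ∈ walkLists n x) : l.length = n := by
  induction n generalizing x l with
  | zero => simp_all [walkLists]
  | succ n ih =>
    simp only [walkLists, Finset.mem_biUnion, Finset.mem_univ, true_and, Finset.mem_image] at h
    obtain ⟨s, l', hl', rfl⟩ := h
    simp [ih hl']

/-- The environments in which some walk of length `R` started in the ball of radius `B` around the
origin has at least half of its edges of weight below `c`. -/
def manyLowEdges (d B R : ℕ) (c : ℝ) : Set (Edge d → ℝ) :=
  {t | ∃ x ∈ ball (0 : Fin d → ℤ) B, ∃ l ∈ walkLists R x,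
    R ≤ 2 * (l.toFinset.filter fun e => t e < c).card}

variable {t : Edge d → ℝ} {c : ℝ} {B : ℕ}

lemma lt_two_mul_countP_of_notMem_manyLowEdges {x y : Fin d → ℤ} {q : (lattice d).Walk x y}
    (hx : l1 x ≤ B) (hq : (edgeList q).Nodup) (ht : t ∉ manyLowEdges d B q.length c) :
    q.length < 2 * (edgeList q).countP (c ≤ t ·) := by
  have hlow : ¬ q.length ≤ 2 * ((edgeList q).toFinset.filter fun e => t e < c).card := fun h =>
    ht ⟨x, by simpa using hx, edgeList q, edgeList_mem_walkLists q, h⟩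
  rw [card_eq_countP_of_nodup hq (P := fun e => ¬ c ≤ t e) (by simp)] at hlow
  have hsplit := List.length_eq_countP_add_countP (l := edgeList q) fun e => decide (c ≤ t e)
  simp only [length_edgeList, decide_eq_true_eq] at hsplit
  omega

lemma countP_mem_le_two_mul {x y : Fin d → ℤ} {q : (lattice d).Walk x y} (hx : l1 x ≤ B)
    (hq : (edgeList q).Nodup) (ht : t ∉ manyLowEdges d B q.length c) (E : Finset (Edge d)) :
    (edgeList q).countP (· ∈ E) ≤
      2 * (edgeList q).countP fun e => e ∈ thickening E q.length ∧ c ≤ t e := by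
  by_cases hE : ∃ e ∈ edgeList q, e ∈ E
  · obtain ⟨e, heq, heE⟩ := hE
    have hthick : (edgeList q).countP (fun e => e ∈ thickening E q.length ∧ c ≤ t e) =
        (edgeList q).countP (c ≤ t ·) :=
      List.countP_congr fun e' he' => by simp [mem_thickening_of_mem_edgeList q heq heE he']
    have hle : (edgeList q).countP (· ∈ E) ≤ q.length :=
      List.countP_le_length.trans_eq (length_edgeList q)
    have := lt_two_mul_countP_of_notMem_manyLowEdges hx hq ht
    omega
  · have : (edgeList q).countP (· ∈ E) = 0 := by
      simpa [List.countP_eq_zero] using fun e he h => hE ⟨e, he, h⟩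
    omega

lemma card_filter_mem_le_four_mul {v : Fin d → ℤ} {p : (lattice d).Walk 0 v} (hp : p.IsPath)
    {R : ℕ} (hR : 0 < R) (hRp : R ≤ p.length) (hpB : p.length ≤ B)
    (ht : t ∉ manyLowEdges d B R c) (E : Finset (Edge d)) :
    (E.filter (· ∈ edgeList p)).card ≤
      4 * ((thickening E R).filter fun e => e ∈ edgeList p ∧ c ≤ t e).card := by
  have hnodup := nodup_edgeList hp
  rw [card_eq_countP_of_nodup hnodup (P := (· ∈ E)) (by simp [and_comm]),
    card_eq_countP_of_nodup hnodup (P := fun e => e ∈ thickening E R ∧ c ≤ t e)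
      (by simp [and_left_comm])]
  refine countP_le_four_mul hR _ (by simpa using hRp) fun k hk => ?_
  rw [length_edgeList] at hk
  set q := (p.drop k).take R with hq
  have hqR : q.length = R := by simp [hq]; omega
  have hqp : edgeList q = ((edgeList p).drop k).take R := by
    rw [hq, edgeList_take, edgeList_drop]
  have hstart : l1 (p.getVert k) ≤ B := by
    have := l1_getVert_sub_le p (Nat.zero_le k)
    rw [SimpleGraph.Walk.getVert_zero, sub_zero] at this
    omega
  have h := countP_mem_le_two_mul (q := q) hstart
    (hqp ▸ (hnodup.sublist (List.drop_sublist _ _)).sublist (List.take_sublist _ _)) (hqR ▸ ht) E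
  rwa [hqR, hqp] at h

end paths

/-! ### Scores -/

section score

variable {G : Measure ℝ} {a b α η : ℝ} {s g : ℝ → ℝ}

/-- `G` is carried by `[a,b] ⊆ (0,∞)` and dominates `α` times Lebesgue measure there. -/
structure HasUniformComponent (G : Measure ℝ) (a b α : ℝ) : Prop where
  pos : 0 < a
  lt : a < b
  mass_pos : 0 < α
  ae_mem : ∀ᵐ x ∂G, x ∈ Set.Icc a b
  le : ENNReal.ofReal α • (volume : Measure ℝ).restrict (Set.Icc a b) ≤ G

lemma IsAdmissibleWeight.exists_hasUniformComponent (hG : IsAdmissibleWeight G) :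
    ∃ a b α : ℝ, HasUniformComponent G a b α := by
  obtain ⟨a, b, α, ha, hab, hα, hsupp, ρ, -, hGρ, hρα⟩ := hG
  refine ⟨a, b, α, ha, hab, hα, hsupp, ?_⟩
  calc ENNReal.ofReal α • (volume : Measure ℝ).restrict (Set.Icc a b)
      = (volume.restrict (Set.Icc a b)).withDensity (fun _ => ENNReal.ofReal α) :=
        (withDensity_const _).symm
    _ ≤ (volume.restrict (Set.Icc a b)).withDensity ρ := withDensity_mono hρα
    _ = G.restrict (Set.Icc a b) := by rw [hGρ, restrict_withDensity measurableSet_Icc]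
    _ ≤ G := Measure.restrict_le_self

lemma IsAdmissibleWeight.nullSingletonClass (hG : IsAdmissibleWeight G) :
    NullSingletonClass G := by
  obtain ⟨-, -, -, -, -, -, -, ρ, -, rfl, -⟩ := hG
  exact ⟨fun x => withDensity_absolutelyContinuous _ _ Real.volume_singleton⟩

lemma HasUniformComponent.mul_volume_real_inter_le [IsFiniteMeasure G]
    (hG : HasUniformComponent G a b α) {A : Set ℝ} (hA : MeasurableSet A) :
    α * volume.real (A ∩ Set.Icc a b) ≤ G.real A := by
  have := ENNReal.toReal_mono (measure_ne_top G A) (hG.le A)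
  rwa [Measure.smul_apply, Measure.restrict_apply hA, smul_eq_mul, ENNReal.toReal_mul,
    ENNReal.toReal_ofReal hG.mass_pos.le] at this

lemma exists_density_of_le {X : Type*} [MeasurableSpace X] {μ ν : Measure X} [IsFiniteMeasure μ]
    (h : ν ≤ μ) :
    ∃ k : X → ℝ, Measurable k ∧ (∀ x, k x ∈ Set.Icc 0 1) ∧
      ∀ f : X → ℝ, ∫ x, k x * f x ∂μ = ∫ x, f x ∂ν := by
  have : IsFiniteMeasure ν := ⟨(h _).trans_lt (measure_lt_top μ _)⟩
  refine ⟨fun x => min (ν.rnDeriv μ x).toReal 1,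
    (Measure.measurable_rnDeriv ν μ).ennreal_toReal.min measurable_const,
    fun x => ⟨le_min ENNReal.toReal_nonneg zero_le_one, min_le_right _ _⟩, fun f => ?_⟩
  rw [← integral_toReal_rnDeriv_mul (Measure.absolutelyContinuous_of_le h)]
  refine integral_congr_ae ?_
  filter_upwards [Measure.rnDeriv_le_one_of_le h] with x hx
  rw [min_eq_left (ENNReal.toReal_le_of_le_ofReal zero_le_one (by simpa using hx))]

/-- A function bounded by one whose pairing with `g` in `L²(G)` is `α` times the difference of the
integrals of `g` over the top and the bottom subinterval of `[a,b]` of length `η`. -/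
structure IsScore (G : Measure ℝ) (a b α η : ℝ) (s : ℝ → ℝ) : Prop where
  measurable : Measurable s
  abs_le_one (x : ℝ) : |s x| ≤ 1
  integral_mul {g : ℝ → ℝ} : IntegrableOn g (Set.Icc a b) →
    ∫ x, s x * g x ∂G = α * ((∫ u in Set.Ioc (b - η) b, g u) - ∫ u in Set.Ioc a (a + η), g u)

lemma HasUniformComponent.exists_isScore [IsFiniteMeasure G] (hG : HasUniformComponent G a b α)
    (hη : η ≤ b - a) : ∃ s, IsScore G a b α η s := by
  obtain ⟨k, measurable_k, hk, integral_k⟩ := exists_density_of_le hG.le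
  set bot := Set.Ioc a (a + η)
  set top := Set.Ioc (b - η) b
  have hbot : bot ⊆ Set.Icc a b := fun x hx => ⟨hx.1.le, hx.2.trans (by linarith)⟩
  have htop : top ⊆ Set.Icc a b := fun x hx => ⟨by linarith [hx.1], hx.2⟩
  refine ⟨fun x => k x * (top.indicator 1 x - bot.indicator 1 x), ?_, fun x => ?_, fun {g} hg => ?_⟩
  · exact measurable_k.mul ((measurable_one.indicator measurableSet_Ioc).sub
      (measurable_one.indicator measurableSet_Ioc))
  · have : |top.indicator (1 : ℝ → ℝ) x - bot.indicator 1 x| ≤ 1 := by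
      simp only [Set.indicator_apply, Pi.one_apply]
      split_ifs <;> simp
    rw [abs_mul, abs_of_nonneg (hk x).1]
    exact mul_le_one₀ (hk x).2 (abs_nonneg _) this
  · have hmul (x) : (top.indicator 1 x - bot.indicator 1 x) * g x =
        top.indicator g x - bot.indicator g x := by
      simp only [Set.indicator_apply, Pi.one_apply]
      split_ifs <;> simp
    simp only [mul_assoc, integral_k, hmul]
    rw [integral_smul_measure, ENNReal.toReal_ofReal hG.mass_pos.le, smul_eq_mul,
      integral_sub (hg.integrable.indicator measurableSet_Ioc)
        (hg.integrable.indicator measurableSet_Ioc),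
      setIntegral_indicator measurableSet_Ioc, setIntegral_indicator measurableSet_Ioc,
      Set.inter_eq_right.2 hbot, Set.inter_eq_right.2 htop]

lemma intervalIntegrable_comp_add_right (hη : 0 ≤ η) (hηab : η ≤ b - a)
    (hg : IntegrableOn g (Set.Icc a b)) :
    IntervalIntegrable (fun u => g (u + (b - a - η))) volume a (a + η) := by
  have : IntervalIntegrable g volume (a + (b - a - η)) (a + η + (b - a - η)) :=
    (hg.mono_set (Set.uIcc_subset_Icc ⟨by linarith, by linarith⟩
      ⟨by linarith, by linarith⟩)).intervalIntegrable
  convert this.comp_add_right (b - a - η) using 1 <;> ring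

lemma intervalIntegrable_bot (hη : 0 ≤ η) (hηab : η ≤ b - a)
    (hg : IntegrableOn g (Set.Icc a b)) : IntervalIntegrable g volume a (a + η) :=
  (hg.mono_set (Set.uIcc_subset_Icc ⟨by linarith, by linarith⟩
    ⟨by linarith, by linarith⟩)).intervalIntegrable

namespace IsScore

lemma integral_eq_zero (hs : IsScore G a b α η s) : ∫ x, s x ∂G = 0 := by
  simpa using hs.integral_mul (g := fun _ => 1) (integrableOn_const (by simp))

lemma integral_mul_eq_increment (hs : IsScore G a b α η s) (hη : 0 ≤ η) (hηab : η ≤ b - a)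
    (hg : IntegrableOn g (Set.Icc a b)) :
    ∫ x, s x * g x ∂G = α * ∫ u in a..(a + η), (g (u + (b - a - η)) - g u) := by
  rw [hs.integral_mul hg, intervalIntegral.integral_sub
      (intervalIntegrable_comp_add_right hη hηab hg) (intervalIntegrable_bot hη hηab hg),
    intervalIntegral.integral_comp_add_right, intervalIntegral.integral_of_le (by linarith),
    intervalIntegral.integral_of_le (by linarith)]
  ring_nf

lemma le_integral_mul (hs : IsScore G a b α η s) (hα : 0 ≤ α) (hη : 0 ≤ η) (hηab : η ≤ b - a)
    (hg : IntegrableOn g (Set.Icc a b)) {δ : ℝ}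
    (hδ : ∀ u ∈ Set.Icc a (a + η), δ ≤ g (u + (b - a - η)) - g u) :
    α * (η * δ) ≤ ∫ x, s x * g x ∂G := by
  rw [hs.integral_mul_eq_increment hη hηab hg]
  refine mul_le_mul_of_nonneg_left ?_ hα
  calc η * δ = ∫ _ in a..(a + η), δ := by simp
    _ ≤ _ := intervalIntegral.integral_mono_on (by linarith) intervalIntegrable_const
      ((intervalIntegrable_comp_add_right hη hηab hg).sub (intervalIntegrable_bot hη hηab hg)) hδ

lemma integral_mul_le [IsFiniteMeasure G] (hs : IsScore G a b α η s)
    (hG : HasUniformComponent G a b α) (hη : 0 ≤ η) (hηab : η ≤ b - a)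
    (hg : IntegrableOn g (Set.Icc a b)) {A : Set ℝ} (hA : MeasurableSet A) {c : ℝ} (hc : 0 ≤ c)
    (hgA : ∀ u ∈ Set.Icc a (a + η), g (u + (b - a - η)) - g u ≤ c * A.indicator 1 u) :
    ∫ x, s x * g x ∂G ≤ c * G.real A := by
  have hα := hG.mass_pos.le
  have hA_int : IntervalIntegrable (A.indicator (1 : ℝ → ℝ)) volume a (a + η) :=
    (intervalIntegrable_iff.2 ((integrableOn_const (by simp)).indicator hA))
  have hsub : A ∩ Set.Ioc a (a + η) ⊆ A ∩ Set.Icc a b :=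
    Set.inter_subset_inter_right A fun u hu => ⟨hu.1.le, by linarith [hu.2]⟩
  have hfin : volume (A ∩ Set.Icc a b) ≠ ∞ :=
    ((measure_mono Set.inter_subset_right).trans_lt measure_Icc_lt_top).ne
  calc ∫ x, s x * g x ∂G = α * ∫ u in a..(a + η), (g (u + (b - a - η)) - g u) :=
        hs.integral_mul_eq_increment hη hηab hg
    _ ≤ α * ∫ u in a..(a + η), c * A.indicator 1 u :=
        mul_le_mul_of_nonneg_left (intervalIntegral.integral_mono_on (by linarith)
          ((intervalIntegrable_comp_add_right hη hηab hg).sub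
            (intervalIntegrable_bot hη hηab hg)) (hA_int.const_mul c) hgA) hα
    _ = c * (α * volume.real (A ∩ Set.Ioc a (a + η))) := by
        rw [intervalIntegral.integral_const_mul, intervalIntegral.integral_of_le (by linarith),
          integral_indicator_one hA, measureReal_restrict_apply hA]
        ring
    _ ≤ c * (α * volume.real (A ∩ Set.Icc a b)) := by gcongr
    _ ≤ c * G.real A := mul_le_mul_of_nonneg_left (hG.mul_volume_real_inter_le hA) hc

end IsScore

end score

/-! ### The random environment -/

section resampling

variable {ι : Type*} [DecidableEq ι] {X : ι → Type*} [∀ i, MeasurableSpace (X i)]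
  (μ : ∀ i, Measure (X i)) [∀ i, IsProbabilityMeasure (μ i)]

lemma measurable_update_prod (i : ι) :
    Measurable fun q : (∀ j, X j) × X i => Function.update q.1 i q.2 := by
  refine measurable_pi_lambda _ fun j => ?_
  rcases eq_or_ne j i with rfl | hj
  · simpa using measurable_snd
  · simpa [hj, Function.comp_def] using (measurable_pi_apply j).comp measurable_fst

lemma measurePreserving_update_infinitePi (i : ι) :
    MeasurePreserving (fun q : (∀ j, X j) × X i => Function.update q.1 i q.2)
      ((Measure.infinitePi μ).prod (μ i)) (Measure.infinitePi μ) := by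
  refine ⟨measurable_update_prod i, Measure.eq_infinitePi _ fun s t ht => ?_⟩
  rw [Measure.map_apply (measurable_update_prod i) (.pi s.countable_toSet fun _ _ => ht _)]
  by_cases hi : i ∈ s
  · have : (fun q : (∀ j, X j) × X i => Function.update q.1 i q.2) ⁻¹' (s : Set ι).pi t =
        ((s.erase i : Finset ι) : Set ι).pi t ×ˢ t i := by
      ext ⟨x, u⟩
      rw [Set.mem_preimage, Set.update_mem_pi_iff, Set.mem_prod, Finset.coe_erase]
      simp [hi]
    rw [this, Measure.prod_prod, Measure.infinitePi_pi _ (fun i _ => ht i),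
      Finset.prod_erase_mul _ _ hi]
  · have : (fun q : (∀ j, X j) × X i => Function.update q.1 i q.2) ⁻¹' (s : Set ι).pi t =
        (s : Set ι).pi t ×ˢ Set.univ := by
      ext ⟨x, u⟩
      rw [Set.mem_preimage, Set.update_mem_pi_iff, Set.mem_prod]
      simp [hi]
    rw [this, Measure.prod_prod, Measure.infinitePi_pi _ (fun i _ => ht i)]
    simp

lemma integrable_integral_update_infinitePi {E : Type*} [NormedAddCommGroup E] [NormedSpace ℝ E]
    {F : (∀ j, X j) → E} (hF : Integrable F (Measure.infinitePi μ)) (i : ι) :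
    Integrable (fun t => ∫ u, F (Function.update t i u) ∂μ i) (Measure.infinitePi μ) :=
  ((measurePreserving_update_infinitePi μ i).integrable_comp_of_integrable hF).integral_prod_left

lemma integral_update_infinitePi {E : Type*} [NormedAddCommGroup E] [NormedSpace ℝ E]
    {F : (∀ j, X j) → E} (hF : Integrable F (Measure.infinitePi μ)) (i : ι) :
    ∫ t, ∫ u, F (Function.update t i u) ∂μ i ∂Measure.infinitePi μ =
      ∫ t, F t ∂Measure.infinitePi μ := by
  have hmp := measurePreserving_update_infinitePi μ i
  have hF' : AEStronglyMeasurable F (((Measure.infinitePi μ).prod (μ i)).map _) :=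
    hmp.map_eq ▸ hF.aestronglyMeasurable
  calc _ = ∫ q : (∀ j, X j) × X i, F (Function.update q.1 i q.2)
        ∂(Measure.infinitePi μ).prod (μ i) :=
        (integral_prod _ (hmp.integrable_comp_of_integrable hF)).symm
    _ = ∫ t, F t ∂Measure.infinitePi μ := by
        rw [← integral_map hmp.aemeasurable hF', hmp.map_eq]

end resampling

section cancellation

variable {Ω ι : Type*} [MeasurableSpace Ω] {μ : Measure Ω} [IsProbabilityMeasure μ]

lemma integral_abs_le_sqrt_integral_sq {X : Ω → ℝ} (hX : MemLp X 2 μ) :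
    ∫ ω, |X ω| ∂μ ≤ √(∫ ω, X ω ^ 2 ∂μ) := by
  have h := (ProbabilityTheory.variance_nonneg _ μ).trans_eq
    (ProbabilityTheory.variance_eq_sub hX.norm)
  exact Real.le_sqrt_of_sq_le (by simpa using h)

lemma integral_sum_sq_le_card {X : ι → Ω → ℝ} (hX : ∀ i, AEStronglyMeasurable (X i) μ)
    (hX1 : ∀ i ω, |X i ω| ≤ 1) (U : Finset ι)
    (horth : ∀ i ∈ U, ∀ j ∈ U, j ≠ i → ∫ ω, X i ω * X j ω ∂μ = 0) :
    ∫ ω, (∑ i ∈ U, X i ω) ^ 2 ∂μ ≤ U.card := by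
  have hint (i j) : Integrable (fun ω => X i ω * X j ω) μ :=
    .of_bound ((hX i).mul (hX j)) 1 (.of_forall fun ω => by
      rw [norm_mul]
      exact mul_le_one₀ (hX1 i ω) (norm_nonneg _) (hX1 j ω))
  have hdiag (i) : ∫ ω, X i ω * X i ω ∂μ ≤ 1 :=
    calc ∫ ω, X i ω * X i ω ∂μ ≤ ∫ _, (1 : ℝ) ∂μ :=
          integral_mono (hint i i) (integrable_const _) fun ω => by
            have := (sq_le_one_iff_abs_le_one _).2 (hX1 i ω)
            rwa [pow_two] at this
      _ = 1 := by simp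
  simp only [pow_two, Finset.sum_mul_sum]
  rw [integral_finsetSum _ fun i _ => integrable_finsetSum _ fun j _ => hint i j]
  calc _ ≤ ∑ _ ∈ U, (1 : ℝ) := Finset.sum_le_sum fun i hi => by
        rw [integral_finsetSum _ fun j _ => hint i j,
          Finset.sum_eq_single_of_mem i hi (horth i hi)]
        exact hdiag i
    _ = U.card := by simp

lemma sum_integral_mul_le_mul_sqrt_card {X : ι → Ω → ℝ}
    (hX : ∀ i, AEStronglyMeasurable (X i) μ) (hX1 : ∀ i ω, |X i ω| ≤ 1) (U : Finset ι)
    (horth : ∀ i ∈ U, ∀ j ∈ U, j ≠ i → ∫ ω, X i ω * X j ω ∂μ = 0) {F : Ω → ℝ}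
    (hF : AEStronglyMeasurable F μ) {M : ℝ} (hM0 : 0 ≤ M) (hM : ∀ᵐ ω ∂μ, |F ω| ≤ M) :
    ∑ i ∈ U, ∫ ω, X i ω * F ω ∂μ ≤ M * √U.card := by
  have hFint : Integrable F μ := .of_bound hF M hM
  have hsum : MemLp (fun ω => ∑ i ∈ U, X i ω) 2 μ :=
    memLp_finsetSum _ fun i _ => .of_bound (hX i) 1 (.of_forall (hX1 i))
  calc ∑ i ∈ U, ∫ ω, X i ω * F ω ∂μ = ∫ ω, (∑ i ∈ U, X i ω) * F ω ∂μ := by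
        rw [← integral_finsetSum _ fun i _ => hFint.bdd_mul (hX i) (.of_forall (hX1 i))]
        simp only [Finset.sum_mul]
    _ ≤ ∫ ω, M * |∑ i ∈ U, X i ω| ∂μ := by
        refine integral_mono_ae ?_ ((hsum.integrable one_le_two).abs.const_mul M) ?_
        · exact (hsum.integrable one_le_two).mul_bdd hF hM
        · filter_upwards [hM] with ω hω
          refine (le_abs_self _).trans ?_
          rw [abs_mul, mul_comm]
          gcongr
    _ = M * ∫ ω, |∑ i ∈ U, X i ω| ∂μ := integral_const_mul _ _
    _ ≤ M * √(∫ ω, (∑ i ∈ U, X i ω) ^ 2 ∂μ) := by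
        gcongr
        exact integral_abs_le_sqrt_integral_sq hsum
    _ ≤ M * √U.card := by
        gcongr
        exact integral_sum_sq_le_card hX hX1 U horth

end cancellation

section environment

variable {G : Measure ℝ} {a b α η : ℝ} {s : ℝ → ℝ}

lemma measurable_pathTime {u v : Fin d → ℤ} (p : (lattice d).Walk u v) :
    Measurable fun t : Edge d → ℝ => pathTime t p := by
  simp only [pathTime_eq_sum]
  induction edgeList p with
  | nil => simp
  | cons e l ih =>
    simp only [List.map_cons, List.sum_cons]
    exact (measurable_pi_apply e).add ih

lemma measurable_passageTime (u v : Fin d → ℤ) :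
    Measurable fun t : Edge d → ℝ => passageTime t u v :=
  Measurable.iInf fun p => measurable_pathTime p

lemma measurableSet_mem_geodesic (u v : Fin d → ℤ) (e : Edge d) :
    MeasurableSet {t : Edge d → ℝ | e ∈ geodesic t u v} := by
  have : {t : Edge d → ℝ | e ∈ geodesic t u v} =
      ⋃ p : (lattice d).Walk u v, {t | IsGeodesic t p ∧ e ∈ edgeList p} := by
    ext t
    simp [mem_geodesic]
  rw [this]
  exact .iUnion fun p =>
    (measurableSet_eq_fun (measurable_pathTime p) (measurable_passageTime u v)).inter (.const _)

lemma abs_passageTime_le {t : Edge d → ℝ} (ht : ∀ e, t e ∈ Set.Icc 0 b) (x y : Fin d → ℤ) :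
    |passageTime t x y| ≤ b * l1 (y - x) := by
  rw [abs_of_nonneg (passageTime_nonneg (fun e => (ht e).1) x y)]
  exact passageTime_le_mul_l1 ht x y

lemma integrableOn_passageTime_update {t : Edge d → ℝ} (ht : ∀ e, t e ∈ Set.Icc 0 b) (ha : 0 ≤ a)
    (x y : Fin d → ℤ) (e : Edge d) :
    IntegrableOn (fun u => passageTime (Function.update t e u) x y) (Set.Icc a b) :=
  Measure.integrableOn_of_bounded (M := b * l1 (y - x)) (by simp)
    ((measurable_passageTime x y).comp (measurable_update t)).aestronglyMeasurable <|
    (ae_restrict_iff' measurableSet_Icc).2 <| .of_forall fun _ hu =>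
      abs_passageTime_le (update_mem ht e (Set.Icc_subset_Icc_left ha hu)) x y

namespace IsScore

variable {t : Edge d → ℝ} {e : Edge d} {x y : Fin d → ℤ}

lemma aestronglyMeasurable_eval (hs : IsScore G a b α η s) (e : Edge d) :
    AEStronglyMeasurable (fun t : Edge d → ℝ => s (t e)) (envMeasure d G) :=
  (hs.measurable.comp (measurable_pi_apply e)).aestronglyMeasurable

lemma integrable_mul (hs : IsScore G a b α η s) {F : (Edge d → ℝ) → ℝ}
    (hF : Integrable F (envMeasure d G)) (e : Edge d) :
    Integrable (fun t => s (t e) * F t) (envMeasure d G) :=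
  hF.bdd_mul (hs.aestronglyMeasurable_eval e) (.of_forall fun t => hs.abs_le_one (t e))

lemma integral_mul_passageTime_nonneg (hs : IsScore G a b α η s) (ha : 0 ≤ a) (hα : 0 ≤ α)
    (hη : 0 ≤ η) (hηab : η ≤ b - a) (ht : ∀ e, t e ∈ Set.Icc a b) :
    0 ≤ ∫ u, s u * passageTime (Function.update t e u) x y ∂G := by
  have ht0 (e) : t e ∈ Set.Icc 0 b := Set.Icc_subset_Icc_left ha (ht e)
  have := hs.le_integral_mul hα hη hηab (integrableOn_passageTime_update ht0 ha x y e) (δ := 0)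
    fun u hu => sub_nonneg.2 <| passageTime_mono
      (update_mem (I := Set.Ici 0) (fun e => (ht0 e).1) e (ha.trans hu.1))
      (update_le_update_iff'.2 (by linarith)) x y
  simpa using this

lemma le_integral_mul_passageTime_of_mem (hs : IsScore G a b α η s) (ha : 0 < a) (hα : 0 ≤ α)
    (hη : 0 ≤ η) (hηab : 2 * η ≤ b - a) (ht : ∀ e, t e ∈ Set.Icc a b) (he : e ∈ geodesic t x y)
    (hte : a + 2 * η ≤ t e) :
    α * η ^ 2 ≤ ∫ u, s u * passageTime (Function.update t e u) x y ∂G := by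
  have ht0 (e) : t e ∈ Set.Icc 0 b := Set.Icc_subset_Icc_left ha.le (ht e)
  rw [pow_two]
  refine hs.le_integral_mul hα hη (by linarith)
    (integrableOn_passageTime_update ht0 ha.le x y e) fun u hu => ?_
  have increase := add_min_le_passageTime_update ha (fun e => (ht e).1) he hu.1
    (by linarith [hu.2]) (show u ≤ u + (b - a - η) by linarith)
  have : η ≤ min (t e - u) (u + (b - a - η) - u) :=
    le_min (by linarith [hu.2]) (by linarith)
  linarith

end IsScore

variable [IsProbabilityMeasure G]

instance : IsProbabilityMeasure (envMeasure d G) := by unfold envMeasure; infer_instance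

lemma ae_forall_mem {I : Set ℝ} (hG : ∀ᵐ x ∂G, x ∈ I) : ∀ᵐ t ∂envMeasure d G, ∀ e, t e ∈ I :=
  ae_all_iff.2 fun e =>
    (measurePreserving_eval_infinitePi (fun _ : Edge d => G) e).quasiMeasurePreserving.ae hG

lemma ae_pathTime_ne [NullSingletonClass G] {u v : Fin d → ℤ} {p q : (lattice d).Walk u v}
    {e : Edge d} (hep : e ∈ edgeList p) (heq : e ∉ edgeList q) :
    ∀ᵐ t ∂envMeasure d G, pathTime t p ≠ pathTime t q := by
  have hmp := measurePreserving_update_infinitePi (fun _ : Edge d => G) e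
  have hms : MeasurableSet {t : Edge d → ℝ | pathTime t p ≠ pathTime t q} :=
    (measurableSet_eq_fun (measurable_pathTime p) (measurable_pathTime q)).compl
  have hp : (1 : ℝ) ≤ (edgeList p).count e := mod_cast List.one_le_count_iff.2 hep
  rw [envMeasure, ← hmp.map_eq, ae_map_iff hmp.aemeasurable hms]
  refine (Measure.ae_prod_iff_ae_ae (hmp.measurable hms)).2 (.of_forall fun t => ?_)
  filter_upwards [Measure.ae_ne G
    (t e - (pathTime t p - pathTime t q) / (edgeList p).count e)] with x hx heq'
  refine hx ?_
  rw [pathTime_update, pathTime_update, List.count_eq_zero.2 heq, Nat.cast_zero, zero_mul] at heq'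
  field_simp
  linarith

lemma ae_geodesic_unique [NullSingletonClass G] (u v : Fin d → ℤ) :
    ∀ᵐ t ∂envMeasure d G, ∀ p q : (lattice d).Walk u v, IsGeodesic t p → IsGeodesic t q →
      edgeList p ⊆ edgeList q := by
  refine ae_all_iff.2 fun p => ae_all_iff.2 fun q => ?_
  by_cases hpq : edgeList p ⊆ edgeList q
  · exact .of_forall fun t _ _ => hpq
  · obtain ⟨e, hep, heq⟩ : ∃ e ∈ edgeList p, e ∉ edgeList q := by
      simpa [List.subset_def] using hpq
    filter_upwards [ae_pathTime_ne (G := G) hep heq] with t ht hp hq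
    exact absurd (hp.trans hq.symm) ht

lemma integrable_of_bounded (hsupp : ∀ᵐ x ∂G, x ∈ Set.Icc a b) {F : (Edge d → ℝ) → ℝ}
    (hF : Measurable F) {M : ℝ} (hM : ∀ t : Edge d → ℝ, (∀ e, t e ∈ Set.Icc a b) → |F t| ≤ M) :
    Integrable F (envMeasure d G) :=
  .of_bound hF.aestronglyMeasurable M ((ae_forall_mem hsupp).mono hM)

lemma integrable_passageTime (ha : 0 ≤ a) (hsupp : ∀ᵐ x ∂G, x ∈ Set.Icc a b) (x y : Fin d → ℤ) :
    Integrable (fun t => passageTime t x y) (envMeasure d G) :=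
  integrable_of_bounded hsupp (measurable_passageTime x y) fun _ ht =>
    abs_passageTime_le (fun e => Set.Icc_subset_Icc_left ha (ht e)) x y

namespace IsScore

lemma integral_mul_eq_integral_update (hs : IsScore G a b α η s) {F : (Edge d → ℝ) → ℝ}
    (hF : Integrable F (envMeasure d G)) (e : Edge d) :
    ∫ t, s (t e) * F t ∂envMeasure d G =
      ∫ t, ∫ u, s u * F (Function.update t e u) ∂G ∂envMeasure d G := by
  simpa [envMeasure] using
    (integral_update_infinitePi (fun _ : Edge d => G) (hs.integrable_mul hF e) e).symm

lemma integrable_integral_mul_update (hs : IsScore G a b α η s) {F : (Edge d → ℝ) → ℝ}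
    (hF : Integrable F (envMeasure d G)) (e : Edge d) :
    Integrable (fun t => ∫ u, s u * F (Function.update t e u) ∂G) (envMeasure d G) := by
  simpa [envMeasure] using
    integrable_integral_update_infinitePi (fun _ : Edge d => G) (hs.integrable_mul hF e) e

lemma integral_mul_eq_zero (hs : IsScore G a b α η s) {e e' : Edge d} (h : e' ≠ e) :
    ∫ t, s (t e) * s (t e') ∂envMeasure d G = 0 := by
  have hint : Integrable (fun t : Edge d → ℝ => s (t e')) (envMeasure d G) :=
    .of_bound (hs.aestronglyMeasurable_eval e') 1 (.of_forall fun t => hs.abs_le_one (t e'))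
  rw [hs.integral_mul_eq_integral_update hint]
  simp [h, integral_mul_const, hs.integral_eq_zero]

lemma sum_integral_mul_le (hs : IsScore G a b α η s) (hsupp : ∀ᵐ x ∂G, x ∈ Set.Icc a b)
    {F : (Edge d → ℝ) → ℝ} (hF : Measurable F) {M : ℝ} (hM0 : 0 ≤ M)
    (hM : ∀ t : Edge d → ℝ, (∀ e, t e ∈ Set.Icc a b) → |F t| ≤ M) (U : Finset (Edge d)) :
    ∑ e ∈ U, ∫ t, s (t e) * F t ∂envMeasure d G ≤ M * √U.card :=
  sum_integral_mul_le_mul_sqrt_card (X := fun e t => s (t e)) hs.aestronglyMeasurable_eval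
    (fun e t => hs.abs_le_one (t e)) U (fun _ _ _ _ h => hs.integral_mul_eq_zero h)
    hF.aestronglyMeasurable hM0 ((ae_forall_mem hsupp).mono hM)

variable {t : Edge d → ℝ} {e : Edge d} {x y : Fin d → ℤ}

lemma integral_mul_passageTime_update_le (hs : IsScore G a b α η s)
    (hG : HasUniformComponent G a b α) (hη : 0 ≤ η) (hηab : η ≤ b - a)
    (ht : ∀ e, t e ∈ Set.Icc a b) :
    ∫ u, s u * passageTime (Function.update t e u) x y ∂G ≤
      (b - a) * G.real {u | e ∈ geodesic (Function.update t e u) x y} := by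
  have ha := hG.pos
  have ht0 (e) : t e ∈ Set.Icc 0 b := Set.Icc_subset_Icc_left ha.le (ht e)
  refine hs.integral_mul_le hG hη hηab (integrableOn_passageTime_update ht0 ha.le x y e)
    (measurable_update t (measurableSet_mem_geodesic x y e)) (sub_nonneg.2 hG.lt.le)
    fun u hu => ?_
  have hlow : ∀ e', a ≤ Function.update t e u e' :=
    update_mem (I := Set.Ici a) (fun e => (ht e).1) e hu.1
  by_cases he : e ∈ geodesic (Function.update t e u) x y
  · have := passageTime_update_le_add ha hlow x y (e := e) (s := u + (b - a - η))
      (by simp; linarith)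
    simp only [Function.update_idem, Function.update_self] at this
    rw [Set.indicator_of_mem (by exact he), Pi.one_apply]
    linarith
  · have := passageTime_update_le_of_notMem ha hlow he (s := u + (b - a - η))
      (by linarith [hu.1])
    rw [Function.update_idem] at this
    rw [Set.indicator_of_notMem (by exact he)]
    linarith

lemma le_integral_mul_passageTime (hs : IsScore G a b α η s) (hG : HasUniformComponent G a b α)
    (hη : 0 ≤ η) (hηab : 2 * η ≤ b - a) (x y : Fin d → ℤ) (e : Edge d) :
    α * η ^ 2 * (envMeasure d G).real {t | e ∈ geodesic t x y ∧ a + 2 * η ≤ t e} ≤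
      ∫ t, s (t e) * passageTime t x y ∂envMeasure d G := by
  have hT := integrable_passageTime hG.pos.le hG.ae_mem x y
  have hA : MeasurableSet {t : Edge d → ℝ | e ∈ geodesic t x y ∧ a + 2 * η ≤ t e} :=
    (measurableSet_mem_geodesic x y e).inter
      (measurableSet_le measurable_const (measurable_pi_apply e))
  rw [hs.integral_mul_eq_integral_update hT, mul_comm, ← smul_eq_mul,
    ← integral_indicator_const _ hA]
  refine integral_mono_ae ((integrable_const _).indicator hA)
    (hs.integrable_integral_mul_update hT e) ?_
  filter_upwards [ae_forall_mem hG.ae_mem] with t ht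
  refine Set.indicator_apply_le' (fun h => ?_) fun _ => ?_
  · exact hs.le_integral_mul_passageTime_of_mem hG.pos hG.mass_pos.le hη hηab ht h.1 h.2
  · exact hs.integral_mul_passageTime_nonneg hG.pos.le hG.mass_pos.le hη (by linarith) ht

lemma integral_mul_passageTime_le (hs : IsScore G a b α η s) (hG : HasUniformComponent G a b α)
    (hη : 0 ≤ η) (hηab : η ≤ b - a) (x y : Fin d → ℤ) (e : Edge d) :
    ∫ t, s (t e) * passageTime t x y ∂envMeasure d G ≤
      (b - a) * (envMeasure d G).real {t | e ∈ geodesic t x y} := by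
  have hT := integrable_passageTime hG.pos.le hG.ae_mem x y
  set A := {t : Edge d → ℝ | e ∈ geodesic t x y}
  have hA : MeasurableSet A := measurableSet_mem_geodesic x y e
  have hA_int : Integrable (A.indicator (1 : (Edge d → ℝ) → ℝ)) (envMeasure d G) :=
    (integrable_const _).indicator hA
  have hsection (t : Edge d → ℝ) : ∫ u, A.indicator 1 (Function.update t e u) ∂G =
      G.real {u | e ∈ geodesic (Function.update t e u) x y} :=
    integral_indicator_one (measurable_update t hA)
  rw [hs.integral_mul_eq_integral_update hT, ← integral_indicator_one hA,
    envMeasure, ← integral_update_infinitePi _ hA_int e, ← integral_const_mul]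
  refine integral_mono_ae (hs.integrable_integral_mul_update hT e)
    ((integrable_integral_update_infinitePi _ hA_int e).const_mul _) ?_
  filter_upwards [ae_forall_mem hG.ae_mem] with t ht
  rw [hsection]
  exact hs.integral_mul_passageTime_update_le hG hη hηab ht

end IsScore

end environment

/-! ### Translations -/

section translation

/-- The translation by `x` as an automorphism of the lattice. -/
def shift (x : Fin d → ℤ) : lattice d ≃g lattice d where
  toEquiv := Equiv.addLeft x
  map_rel_iff' := by simp [lattice_adj_iff]

/-- The action on edges of the translation by `x`. -/
def shiftEdge (x : Fin d → ℤ) : Edge d ≃ Edge d := (shift x).mapEdgeSet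

lemma val_shiftEdge (x : Fin d → ℤ) (e : Edge d) :
    (shiftEdge x e : Sym2 (Fin d → ℤ)) = Sym2.map (x + ·) e := rfl

lemma shiftEdge_neg (x : Fin d → ℤ) : shiftEdge (-x) = (shiftEdge x).symm := by
  refine Equiv.ext fun e => (shiftEdge x).eq_symm_apply.2 (Subtype.ext ?_)
  rw [val_shiftEdge, val_shiftEdge, Sym2.map_map]
  simp

lemma shiftEdge_left_injective (e : Edge d) : Function.Injective fun x => shiftEdge x e := by
  intro x x' h
  obtain ⟨⟨p, q⟩, he⟩ := e
  have h' : s(x + p, x + q) = s(x' + p, x' + q) := congrArg Subtype.val h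
  rw [Sym2.eq_iff] at h'
  rcases h' with ⟨hpp, -⟩ | ⟨hpq, hqp⟩
  · exact add_right_cancel hpp
  · funext i
    have := congrFun hpq i
    have := congrFun hqp i
    simp only [Pi.add_apply] at *
    omega

variable {u v : Fin d → ℤ}

/-- The translate of a walk. -/
def shiftWalk (x : Fin d → ℤ) (p : (lattice d).Walk u v) : (lattice d).Walk (x + u) (x + v) :=
  p.map (shift x).toHom

lemma edgeList_shiftWalk (x : Fin d → ℤ) (p : (lattice d).Walk u v) :
    edgeList (shiftWalk x p) = (edgeList p).map (shiftEdge x) := by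
  refine List.map_injective_iff.2 Subtype.val_injective ?_
  rw [map_val_edgeList]
  refine (SimpleGraph.Walk.edges_map _ p).trans ?_
  rw [← map_val_edgeList, List.map_map, List.map_map]
  rfl

lemma pathTime_shiftWalk (t : Edge d → ℝ) (x : Fin d → ℤ) (p : (lattice d).Walk u v) :
    pathTime t (shiftWalk x p) = pathTime (t ∘ shiftEdge x) p := by
  rw [pathTime_eq_sum, pathTime_eq_sum, edgeList_shiftWalk, List.map_map]

lemma passageTime_add_left_le {t : Edge d → ℝ} (ht : ∀ e, 0 ≤ t e) (x u v : Fin d → ℤ) :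
    passageTime t (x + u) (x + v) ≤ passageTime (t ∘ shiftEdge x) u v :=
  le_ciInf fun p => (passageTime_le ht _).trans (pathTime_shiftWalk t x p).le

lemma passageTime_comp_shiftEdge {t : Edge d → ℝ} (ht : ∀ e, 0 ≤ t e) (x u v : Fin d → ℤ) :
    passageTime (t ∘ shiftEdge x) u v = passageTime t (x + u) (x + v) := by
  refine le_antisymm ?_ (passageTime_add_left_le ht x u v)
  have := passageTime_add_left_le (t := t ∘ shiftEdge x) (fun e => ht _) (-x) (x + u) (x + v)
  simpa [shiftEdge_neg, Function.comp_assoc] using this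

lemma shiftEdge_mem_geodesic_of_mem {t : Edge d → ℝ} (ht : ∀ e, 0 ≤ t e) (x : Fin d → ℤ)
    {e : Edge d} (he : e ∈ geodesic (t ∘ shiftEdge x) u v) :
    shiftEdge x e ∈ geodesic t (x + u) (x + v) := by
  obtain ⟨p, hp, hep⟩ := mem_geodesic.1 he
  refine mem_geodesic.2 ⟨shiftWalk x p, ?_, ?_⟩
  · exact (pathTime_shiftWalk t x p).trans (hp.trans (passageTime_comp_shiftEdge ht x u v))
  · rw [edgeList_shiftWalk]
    exact List.mem_map_of_mem hep

lemma shiftEdge_mem_geodesic_iff {t : Edge d → ℝ} (ht : ∀ e, 0 ≤ t e) (x : Fin d → ℤ)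
    {e : Edge d} :
    shiftEdge x e ∈ geodesic t (x + u) (x + v) ↔ e ∈ geodesic (t ∘ shiftEdge x) u v := by
  refine ⟨fun he => ?_, shiftEdge_mem_geodesic_of_mem ht x⟩
  have := shiftEdge_mem_geodesic_of_mem (t := t ∘ shiftEdge x) (fun e => ht _) (-x)
    (e := shiftEdge x e) (by simpa [shiftEdge_neg, Function.comp_assoc] using he)
  simpa [shiftEdge_neg] using this

variable {G : Measure ℝ} [IsProbabilityMeasure G]

lemma measurePreserving_comp_shiftEdge (x : Fin d → ℤ) :
    MeasurePreserving (fun t : Edge d → ℝ => t ∘ shiftEdge x) (envMeasure d G)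
      (envMeasure d G) :=
  ⟨measurable_pi_lambda _ fun _ => measurable_pi_apply _,
    Measure.map_infinitePi_infinitePi_of_inj (P := fun _ : Edge d => G) (shiftEdge x).injective⟩

lemma measureReal_shiftEdge_mem_geodesic (hsupp : ∀ᵐ x ∂G, 0 ≤ x) (x u v : Fin d → ℤ)
    (e : Edge d) :
    (envMeasure d G).real {t | shiftEdge x e ∈ geodesic t (x + u) (x + v)} =
      (envMeasure d G).real {t | e ∈ geodesic t u v} := by
  rw [← (measurePreserving_comp_shiftEdge x).measureReal_preimage
    (measurableSet_mem_geodesic u v e).nullMeasurableSet]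
  refine measureReal_congr ?_
  filter_upwards [ae_forall_mem (I := Set.Ici 0) hsupp] with t ht
  exact propext (shiftEdge_mem_geodesic_iff ht x)

end translation

/-! ### Rarity of paths with many low edges -/

section lowEdges

variable {c : ℝ} {R : ℕ}

lemma setOf_le_card_filter_lt (L : Finset (Edge d)) (R : ℕ) (c : ℝ) :
    {t : Edge d → ℝ | R ≤ 2 * (L.filter (t · < c)).card} =
      ⋃ S ∈ L.powerset.filter fun S => R ≤ 2 * S.card,
        (S : Set (Edge d)).pi fun _ => Set.Iio c := by
  ext t
  simp only [Set.mem_ofPred_eq, Set.mem_iUnion, Finset.mem_filter, Finset.mem_powerset, exists_prop]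
  refine ⟨fun h => ⟨L.filter (t · < c), ⟨Finset.filter_subset _ _, h⟩, fun e he => ?_⟩, ?_⟩
  · exact (Finset.mem_filter.1 he).2
  · rintro ⟨S, ⟨hSL, hS⟩, ht⟩
    refine hS.trans (Nat.mul_le_mul_left 2 (Finset.card_le_card fun e he => ?_))
    exact Finset.mem_filter.2 ⟨hSL he, ht e he⟩

lemma manyLowEdges_eq_iUnion (B R : ℕ) (c : ℝ) :
    manyLowEdges d B R c = ⋃ x ∈ ball (0 : Fin d → ℤ) B, ⋃ l ∈ walkLists R x,
      {t : Edge d → ℝ | R ≤ 2 * (l.toFinset.filter (t · < c)).card} := by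
  ext t
  simp [manyLowEdges]

lemma measurableSet_manyLowEdges (B R : ℕ) (c : ℝ) : MeasurableSet (manyLowEdges d B R c) := by
  simp only [manyLowEdges_eq_iUnion, setOf_le_card_filter_lt]
  refine Finset.measurableSet_biUnion _ fun x _ => Finset.measurableSet_biUnion _ fun l _ =>
    Finset.measurableSet_biUnion _ fun S _ => ?_
  exact .pi S.countable_toSet fun _ _ => measurableSet_Iio

variable {G : Measure ℝ} [IsProbabilityMeasure G] {θ : ℝ}

lemma measureReal_pi_Iio_le (hθ0 : 0 ≤ θ) (hθ1 : θ ≤ 1) (hc : G.real (Set.Iio c) ≤ θ ^ 2)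
    {S : Finset (Edge d)} (hS : R ≤ 2 * S.card) :
    (envMeasure d G).real ((S : Set (Edge d)).pi fun _ => Set.Iio c) ≤ θ ^ R := by
  rw [envMeasure, Measure.real, Measure.infinitePi_pi _ fun _ _ => measurableSet_Iio,
    Finset.prod_const, ENNReal.toReal_pow]
  calc G.real (Set.Iio c) ^ S.card ≤ (θ ^ 2) ^ S.card :=
        pow_le_pow_left₀ measureReal_nonneg hc _
    _ = θ ^ (2 * S.card) := by rw [pow_mul]
    _ ≤ θ ^ R := pow_le_pow_of_le_one hθ0 hθ1 hS

lemma measureReal_le_card_filter_lt_le (hθ0 : 0 ≤ θ) (hθ1 : θ ≤ 1)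
    (hc : G.real (Set.Iio c) ≤ θ ^ 2) (L : Finset (Edge d)) :
    (envMeasure d G).real {t | R ≤ 2 * (L.filter (t · < c)).card} ≤ 2 ^ L.card * θ ^ R := by
  rw [setOf_le_card_filter_lt]
  refine (measureReal_biUnion_finset_le _ _).trans <| (Finset.sum_le_card_nsmul _ _ (θ ^ R)
    fun S hS => measureReal_pi_Iio_le hθ0 hθ1 hc (Finset.mem_filter.1 hS).2).trans ?_
  rw [nsmul_eq_mul]
  gcongr
  exact_mod_cast (Finset.card_filter_le _ _).trans_eq (Finset.card_powerset L)

lemma measureReal_manyLowEdges_le (hθ0 : 0 ≤ θ) (hθ1 : θ ≤ 1)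
    (hc : G.real (Set.Iio c) ≤ θ ^ 2) (B R : ℕ) :
    (envMeasure d G).real (manyLowEdges d B R c) ≤ (2 * B + 1) ^ d * (4 * d * θ) ^ R := by
  have hlist (x : Fin d → ℤ) (l) (hl : l ∈ walkLists R x) :
      (envMeasure d G).real {t | R ≤ 2 * (l.toFinset.filter (t · < c)).card} ≤ 2 ^ R * θ ^ R := by
    refine (measureReal_le_card_filter_lt_le hθ0 hθ1 hc _).trans ?_
    gcongr
    · norm_num
    · exact (List.toFinset_card_le l).trans (length_of_mem_walkLists hl).le
  have hstart (x : Fin d → ℤ) : (envMeasure d G).real (⋃ l ∈ walkLists R x,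
      {t | R ≤ 2 * (l.toFinset.filter (t · < c)).card}) ≤ (2 * d) ^ R * (2 ^ R * θ ^ R) := by
    refine (measureReal_biUnion_finset_le _ _).trans <|
      (Finset.sum_le_card_nsmul _ _ _ (hlist x)).trans ?_
    rw [nsmul_eq_mul]
    gcongr
    exact_mod_cast card_walkLists_le R x
  rw [manyLowEdges_eq_iUnion]
  refine (measureReal_biUnion_finset_le _ _).trans <|
    (Finset.sum_le_card_nsmul _ _ _ fun x _ => hstart x).trans ?_
  rw [nsmul_eq_mul, show (4 * d * θ : ℝ) = 2 * d * (2 * θ) by ring, mul_pow (2 * d : ℝ),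
    mul_pow 2 θ]
  gcongr
  exact_mod_cast card_ball_le (0 : Fin d → ℤ) B

end lowEdges

/-! ### Expected number of geodesic edges -/

section indicator

variable {ι Ω : Type*} (S : Finset ι) {A : ι → Set Ω}

lemma sum_indicator_eq_card (ω : Ω) [DecidablePred fun i => ω ∈ A i] :
    ∑ i ∈ S, (A i).indicator (1 : Ω → ℝ) ω = (S.filter fun i => ω ∈ A i).card := by
  simp [Set.indicator_apply]

variable [MeasurableSpace Ω] {μ : Measure Ω} [IsFiniteMeasure μ]

lemma integrable_sum_indicator (hA : ∀ i, MeasurableSet (A i)) :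
    Integrable (fun ω => ∑ i ∈ S, (A i).indicator (1 : Ω → ℝ) ω) μ :=
  integrable_finsetSum _ fun i _ => (integrable_const (1 : ℝ)).indicator (hA i)

lemma integral_sum_indicator (hA : ∀ i, MeasurableSet (A i)) :
    ∫ ω, ∑ i ∈ S, (A i).indicator (1 : Ω → ℝ) ω ∂μ = ∑ i ∈ S, μ.real (A i) := by
  rw [integral_finsetSum (f := fun i => (A i).indicator (1 : Ω → ℝ)) _
    fun i _ => (integrable_const (1 : ℝ)).indicator (hA i)]
  exact Finset.sum_congr rfl fun i _ => integral_indicator_one (hA i)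

end indicator

section expectation

variable {G : Measure ℝ} [IsProbabilityMeasure G] {a b : ℝ}

lemma ae_exists_geodesic_path [NullSingletonClass G] (ha : 0 < a)
    (hsupp : ∀ᵐ x ∂G, x ∈ Set.Icc a b) (u v : Fin d → ℤ) :
    ∀ᵐ t ∂envMeasure d G, (∀ e, t e ∈ Set.Icc a b) ∧ ∃ p : (lattice d).Walk u v,
      IsGeodesic t p ∧ p.IsPath ∧ ∀ e, e ∈ geodesic t u v ↔ e ∈ edgeList p := by
  filter_upwards [ae_forall_mem hsupp, ae_geodesic_unique u v] with t ht hunique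
  obtain ⟨p, hp, hpath⟩ := exists_isGeodesic_isPath ha (fun e => (ht e).1) u v
  refine ⟨ht, p, hp, hpath, fun e => ⟨fun he => ?_, fun he => mem_geodesic.2 ⟨p, hp, he⟩⟩⟩
  obtain ⟨q, hq, heq⟩ := mem_geodesic.1 he
  exact hunique q p hq hp heq

lemma sum_measureReal_mem_geodesic_le [NullSingletonClass G] (ha : 0 < a)
    (hsupp : ∀ᵐ x ∂G, x ∈ Set.Icc a b) (u v : Fin d → ℤ) (S : Finset (Edge d)) {K : ℝ}
    (hK : ∀ t : Edge d → ℝ, (∀ e, t e ∈ Set.Icc a b) → ∀ p : (lattice d).Walk u v,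
      IsGeodesic t p → ((S.filter (· ∈ edgeList p)).card : ℝ) ≤ K) :
    ∑ e ∈ S, (envMeasure d G).real {t | e ∈ geodesic t u v} ≤ K := by
  classical
  have hm : ∀ e : Edge d, MeasurableSet {t | e ∈ geodesic t u v} :=
    measurableSet_mem_geodesic u v
  rw [← integral_sum_indicator S hm]
  calc _ ≤ ∫ _, K ∂envMeasure d G := by
        refine integral_mono_ae (integrable_sum_indicator S hm) (integrable_const _) ?_
        filter_upwards [ae_exists_geodesic_path ha hsupp u v] with t ⟨ht, p, hp, _, hmem⟩
        rw [sum_indicator_eq_card]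
        simpa only [Set.mem_ofPred_eq, hmem] using hK t ht p hp
    _ = K := by simp

lemma sum_edgeBall_measureReal_le [NullSingletonClass G] (ha : 0 < a) (hab : a ≤ b)
    (hsupp : ∀ᵐ x ∂G, x ∈ Set.Icc a b) (u v z : Fin d → ℤ) (n : ℕ) :
    ∑ e ∈ edgeBall z n, (envMeasure d G).real {t | e ∈ geodesic t u v} ≤
      b / a * (2 * (n + 1)) + 1 :=
  sum_measureReal_mem_geodesic_le ha hsupp u v _ fun _ ht _ hp =>
    hp.card_edgeBall_filter_le ha hab ht z n

lemma sum_measureReal_le_mul_l1 [NullSingletonClass G] (ha : 0 < a)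
    (hsupp : ∀ᵐ x ∂G, x ∈ Set.Icc a b) (u v : Fin d → ℤ) (S : Finset (Edge d)) :
    ∑ e ∈ S, (envMeasure d G).real {t | e ∈ geodesic t u v} ≤ b / a * l1 (v - u) := by
  refine sum_measureReal_mem_geodesic_le ha hsupp u v S fun t ht p hp => ?_
  refine le_trans ?_ (hp.length_le ha ht)
  rw [← length_edgeList]
  refine mod_cast (Finset.card_le_card fun e he => ?_).trans (List.toFinset_card_le (edgeList p))
  exact List.mem_toFinset.2 (Finset.mem_filter.1 he).2

lemma card_filter_geodesic_le_of_notMem {c : ℝ} {t : Edge d → ℝ} {v : Fin d → ℤ}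
    {p : (lattice d).Walk 0 v} (ha : 0 < a) (ht : ∀ e, t e ∈ Set.Icc a b) (hp : IsGeodesic t p)
    (hpath : p.IsPath) {R B : ℕ} (hR : 0 < R) (hRv : R ≤ l1 v) (hB : b / a * l1 v ≤ B)
    (hlow : t ∉ manyLowEdges d B R c) (E : Finset (Edge d)) :
    (E.filter (· ∈ edgeList p)).card ≤
      4 * ((thickening E R).filter fun e => e ∈ edgeList p ∧ c ≤ t e).card := by
  refine card_filter_mem_le_four_mul hpath hR (hRv.trans ?_) ?_ hlow E
  · simpa using l1_getVert_sub_le p (Nat.zero_le p.length)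
  · have := hp.length_le ha ht
    rw [sub_zero] at this
    exact mod_cast this.trans hB

lemma sum_measureReal_le_four_mul [NullSingletonClass G] {c : ℝ} (ha : 0 < a)
    (hsupp : ∀ᵐ x ∂G, x ∈ Set.Icc a b) (v : Fin d → ℤ) {R B : ℕ} (hR : 0 < R) (hRv : R ≤ l1 v)
    (hB : b / a * l1 v ≤ B) (E : Finset (Edge d)) :
    ∑ e ∈ E, (envMeasure d G).real {t | e ∈ geodesic t 0 v} ≤
      4 * ∑ e ∈ thickening E R, (envMeasure d G).real {t | e ∈ geodesic t 0 v ∧ c ≤ t e} +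
        E.card * (envMeasure d G).real (manyLowEdges d B R c) := by
  classical
  have hm : ∀ e : Edge d, MeasurableSet {t | e ∈ geodesic t 0 v} :=
    measurableSet_mem_geodesic 0 v
  have hm' : ∀ e : Edge d, MeasurableSet {t | e ∈ geodesic t 0 v ∧ c ≤ t e} := fun e =>
    (hm e).inter (measurableSet_le measurable_const (measurable_pi_apply e))
  have hlow : MeasurableSet (manyLowEdges d B R c) := measurableSet_manyLowEdges B R c
  have hint' := (integrable_sum_indicator (μ := envMeasure d G) (thickening E R) hm').const_mul 4
  have hint : Integrable
      (fun t => E.card * (manyLowEdges d B R c).indicator (1 : (Edge d → ℝ) → ℝ) t)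
      (envMeasure d G) := ((integrable_const (1 : ℝ)).indicator hlow).const_mul _
  rw [← integral_sum_indicator E hm, ← integral_sum_indicator _ hm',
    ← integral_indicator_one hlow, ← integral_const_mul, ← integral_const_mul,
    ← integral_add hint' hint]
  refine integral_mono_ae (integrable_sum_indicator _ hm) (hint'.add hint) ?_
  filter_upwards [ae_exists_geodesic_path ha hsupp 0 v] with t ⟨ht, p, hp, hpath, hmem⟩
  rw [sum_indicator_eq_card, sum_indicator_eq_card]
  simp only [Set.mem_ofPred_eq, hmem]
  by_cases htlow : t ∈ manyLowEdges d B R c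
  · rw [Set.indicator_of_mem htlow, Pi.one_apply, mul_one]
    exact le_add_of_nonneg_of_le (by positivity) (mod_cast Finset.card_filter_le _ _)
  · rw [Set.indicator_of_notMem htlow, mul_zero, add_zero]
    exact mod_cast card_filter_geodesic_le_of_notMem ha ht hp hpath hR hRv hB htlow E

/-- The discrete cube of side `w` with lowest corner at the origin. -/
noncomputable def cube (d w : ℕ) : Finset (Fin d → ℤ) :=
  Fintype.piFinset fun _ => Finset.Ico (0 : ℤ) w

lemma card_cube (d w : ℕ) : (cube d w).card = w ^ d := by simp [cube]

lemma l1_le_of_mem_cube {w : ℕ} {x : Fin d → ℤ} (hx : x ∈ cube d w) : l1 x ≤ d * w := by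
  refine (Finset.sum_le_card_nsmul _ _ w fun i _ => ?_).trans (by simp)
  have := Finset.mem_Ico.1 (Fintype.mem_piFinset.1 hx i)
  omega

lemma sum_cube_measureReal_le [NullSingletonClass G] (ha : 0 < a) (hab : a ≤ b)
    (hsupp : ∀ᵐ x ∂G, x ∈ Set.Icc a b) (v : Fin d → ℤ) (w : ℕ) (e : Edge d) :
    ∑ x ∈ cube d w, (envMeasure d G).real {t | e ∈ geodesic t x (x + v)} ≤
      b / a * (2 * ((d * w : ℕ) + 1)) + 1 := by
  have hinj : Function.Injective fun x : Fin d → ℤ => shiftEdge (-x) e := fun x x' h =>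
    neg_injective (shiftEdge_left_injective e h)
  calc ∑ x ∈ cube d w, (envMeasure d G).real {t | e ∈ geodesic t x (x + v)}
      = ∑ x ∈ cube d w, (envMeasure d G).real {t | shiftEdge (-x) e ∈ geodesic t 0 v} := by
        refine Finset.sum_congr rfl fun x _ => ?_
        rw [← measureReal_shiftEdge_mem_geodesic (hsupp.mono fun y hy => ha.le.trans hy.1) (-x)]
        simp
    _ = ∑ e' ∈ (cube d w).image fun x => shiftEdge (-x) e,
          (envMeasure d G).real {t | e' ∈ geodesic t 0 v} := by
        rw [Finset.sum_image fun x _ x' _ h => hinj h]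
    _ ≤ ∑ e' ∈ edgeBall e.base (d * w), (envMeasure d G).real {t | e' ∈ geodesic t 0 v} := by
        refine Finset.sum_le_sum_of_subset_of_nonneg ?_ fun _ _ _ => measureReal_nonneg
        refine Finset.image_subset_iff.2 fun x hx => mem_edgeBall.2 ⟨-x + e.base, ?_, ?_⟩
        · exact Sym2.mem_map.2 ⟨_, e.base_mem, rfl⟩
        · rw [add_sub_cancel_right, l1_neg]
          exact l1_le_of_mem_cube hx
    _ ≤ b / a * (2 * ((d * w : ℕ) + 1)) + 1 :=
        sum_edgeBall_measureReal_le ha hab hsupp 0 v e.base (d * w)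

end expectation

/-! ### The number of edges of large influence -/

section averaging

/-- The passage time between `0` and `v`, averaged over the translations by the points of the cube
of side `w`. -/
noncomputable def averagedPassageTime (w : ℕ) (t : Edge d → ℝ) (v : Fin d → ℤ) : ℝ :=
  (∑ x ∈ cube d w, passageTime t x (x + v)) / w ^ d

lemma measurable_averagedPassageTime (w : ℕ) (v : Fin d → ℤ) :
    Measurable fun t : Edge d → ℝ => averagedPassageTime w t v :=
  (Finset.measurable_sum _ fun x _ => measurable_passageTime x (x + v)).div_const _

variable {b : ℝ} {w : ℕ}

lemma abs_passageTime_sub_averagedPassageTime_le {t : Edge d → ℝ}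
    (ht : ∀ e, t e ∈ Set.Icc 0 b) (hb : 0 ≤ b) (hw : 0 < w) (v : Fin d → ℤ) :
    |passageTime t 0 v - averagedPassageTime w t v| ≤ 2 * b * d * w := by
  have hwd : (0 : ℝ) < (w : ℝ) ^ d := by positivity
  have hshift : ∀ x ∈ cube d w, |passageTime t 0 v - passageTime t x (x + v)| ≤ 2 * b * d * w := by
    intro x hx
    have hdiff := abs_passageTime_sub_le ht 0 x v (x + v)
    rw [zero_sub, l1_neg, show v - (x + v) = -x by abel, l1_neg] at hdiff
    have hx1 : (l1 x : ℝ) ≤ d * w := mod_cast l1_le_of_mem_cube hx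
    linarith [mul_le_mul_of_nonneg_left hx1 hb]
  have haverage : passageTime t 0 v - averagedPassageTime w t v =
      (∑ x ∈ cube d w, (passageTime t 0 v - passageTime t x (x + v))) / w ^ d := by
    rw [Finset.sum_sub_distrib, Finset.sum_const, card_cube, nsmul_eq_mul, sub_div,
      averagedPassageTime, Nat.cast_pow, mul_div_cancel_left₀ _ hwd.ne']
  rw [haverage, abs_div, abs_of_pos hwd, div_le_iff₀ hwd]
  calc |∑ x ∈ cube d w, (passageTime t 0 v - passageTime t x (x + v))|
      ≤ ∑ x ∈ cube d w, |passageTime t 0 v - passageTime t x (x + v)| :=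
        Finset.abs_sum_le_sum_abs _ _
    _ ≤ (cube d w).card • (2 * b * d * w) := Finset.sum_le_card_nsmul _ _ _ hshift
    _ = 2 * b * d * w * w ^ d := by rw [card_cube, nsmul_eq_mul, Nat.cast_pow, mul_comm]

variable {G : Measure ℝ} [IsProbabilityMeasure G] {a α η : ℝ} {s : ℝ → ℝ}

lemma integrable_averagedPassageTime (ha : 0 ≤ a) (hsupp : ∀ᵐ x ∂G, x ∈ Set.Icc a b) (w : ℕ)
    (v : Fin d → ℤ) : Integrable (fun t => averagedPassageTime w t v) (envMeasure d G) :=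
  (integrable_finsetSum _ fun x _ => integrable_passageTime ha hsupp x (x + v)).div_const _

lemma IsScore.integral_mul_averagedPassageTime_le [NullSingletonClass G]
    (hs : IsScore G a b α η s) (hG : HasUniformComponent G a b α) (hη : 0 ≤ η)
    (hηab : η ≤ b - a) (v : Fin d → ℤ) (hw : 0 < w) (e : Edge d) :
    ∫ t, s (t e) * averagedPassageTime w t v ∂envMeasure d G ≤
      (b - a) * (b / a * (2 * (d + 1)) + 1) * w / w ^ d := by
  have hint (x : Fin d → ℤ) := hs.integrable_mul
    (integrable_passageTime (d := d) hG.pos.le hG.ae_mem x (x + v)) e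
  have hba : 0 ≤ b - a := sub_nonneg.2 hG.lt.le
  have hb_a : 0 ≤ b / a := div_nonneg (hG.pos.trans hG.lt).le hG.pos.le
  have hw1 : (1 : ℝ) ≤ w := mod_cast hw
  calc ∫ t, s (t e) * averagedPassageTime w t v ∂envMeasure d G
      = (∑ x ∈ cube d w, ∫ t, s (t e) * passageTime t x (x + v) ∂envMeasure d G) / w ^ d := by
        rw [← integral_finsetSum _ fun x _ => hint x, ← integral_div]
        simp only [averagedPassageTime, mul_div_assoc', Finset.mul_sum]
    _ ≤ (∑ x ∈ cube d w, (b - a) * (envMeasure d G).real {t | e ∈ geodesic t x (x + v)}) /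
          w ^ d := by
        gcongr with x
        exact hs.integral_mul_passageTime_le hG hη hηab x (x + v) e
    _ ≤ (b - a) * (b / a * (2 * ((d * w : ℕ) + 1)) + 1) / w ^ d := by
        rw [← Finset.mul_sum]
        gcongr
        exact sum_cube_measureReal_le hG.pos hG.lt.le hG.ae_mem v w e
    _ ≤ (b - a) * ((b / a * (2 * (d + 1)) + 1) * w) / w ^ d := by
        gcongr
        push_cast
        linarith [mul_nonneg hb_a (sub_nonneg.2 hw1)]
    _ = (b - a) * (b / a * (2 * (d + 1)) + 1) * w / w ^ d := by rw [mul_assoc (b - a)]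

lemma sum_measureReal_high_le [NullSingletonClass G] (hG : HasUniformComponent G a b α)
    (hη : 0 ≤ η) (hηab : 2 * η ≤ b - a) (v : Fin d → ℤ) (U : Finset (Edge d)) (hw : 0 < w) :
    α * η ^ 2 * ∑ e ∈ U, (envMeasure d G).real {t | e ∈ geodesic t 0 v ∧ a + 2 * η ≤ t e} ≤
      U.card * ((b - a) * (b / a * (2 * (d + 1)) + 1) * w / w ^ d) +
        2 * b * d * w * √U.card := by
  obtain ⟨s, hs⟩ := hG.exists_isScore (show η ≤ b - a by linarith)
  have hb : 0 ≤ b := (hG.pos.trans hG.lt).le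
  have hpair (e : Edge d) :
      α * η ^ 2 * (envMeasure d G).real {t | e ∈ geodesic t 0 v ∧ a + 2 * η ≤ t e} ≤
        (b - a) * (b / a * (2 * (d + 1)) + 1) * w / w ^ d +
          ∫ t, s (t e) * (passageTime t 0 v - averagedPassageTime w t v) ∂envMeasure d G := by
    simp only [mul_sub]
    rw [integral_sub (hs.integrable_mul (integrable_passageTime hG.pos.le hG.ae_mem 0 v) e)
      (hs.integrable_mul (integrable_averagedPassageTime hG.pos.le hG.ae_mem w v) e)]
    have hlow := hs.le_integral_mul_passageTime hG hη hηab 0 v e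
    have hup := hs.integral_mul_averagedPassageTime_le hG hη (by linarith) v hw e
    linarith
  have hcancel := hs.sum_integral_mul_le hG.ae_mem
    ((measurable_passageTime 0 v).sub (measurable_averagedPassageTime w v))
    (M := 2 * b * d * w) (by positivity)
    (fun t ht => abs_passageTime_sub_averagedPassageTime_le
      (fun e => Set.Icc_subset_Icc_left hG.pos.le (ht e)) hb hw v) U
  have hsum := Finset.sum_le_sum fun e (_ : e ∈ U) => hpair e
  rw [Finset.sum_add_distrib, Finset.sum_const, nsmul_eq_mul, ← Finset.mul_sum] at hsum
  exact hsum.trans (add_le_add_right hcancel _)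

lemma mul_card_le_of_le_measureReal [NullSingletonClass G] (hG : HasUniformComponent G a b α)
    (hη : 0 ≤ η) (hηab : 2 * η ≤ b - a) (v : Fin d → ℤ) {R B : ℕ} (hR : 0 < R) (hRv : R ≤ l1 v)
    (hB : b / a * l1 v ≤ B) {ε : ℝ}
    (hlow : (envMeasure d G).real (manyLowEdges d B R (a + 2 * η)) ≤ ε / 2) {E : Finset (Edge d)}
    (hE : ∀ e ∈ E, ε ≤ (envMeasure d G).real {t | e ∈ geodesic t 0 v}) (hw : 0 < w) :
    α * η ^ 2 / 8 * ε * E.card ≤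
      (thickening E R).card * ((b - a) * (b / a * (2 * (d + 1)) + 1) * w / w ^ d) +
        2 * b * d * w * √(thickening E R).card := by
  set high := ∑ e ∈ thickening E R,
    (envMeasure d G).real {t | e ∈ geodesic t 0 v ∧ a + 2 * η ≤ t e}
  have hεE : ε * E.card ≤ 8 * high := by
    have hhalf := sum_measureReal_le_four_mul (c := a + 2 * η) hG.pos hG.ae_mem v hR hRv hB E
    have hcard := Finset.card_nsmul_le_sum E _ ε hE
    rw [nsmul_eq_mul] at hcard
    have := mul_le_mul_of_nonneg_left hlow (Nat.cast_nonneg E.card)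
    linarith
  have hα := hG.mass_pos.le
  calc α * η ^ 2 / 8 * ε * E.card = α * η ^ 2 / 8 * (ε * E.card) := by ring
    _ ≤ α * η ^ 2 / 8 * (8 * high) := by gcongr
    _ = α * η ^ 2 * high := by ring
    _ ≤ _ := sum_measureReal_high_le hG hη hηab v (thickening E R) hw

end averaging

section scale

lemma exists_nat_le_pow_and_le_rpow {n : ℕ} (hn : n ≠ 0) {y : ℝ} (hy : 1 ≤ y) :
    ∃ w : ℕ, 0 < w ∧ y ≤ w ^ n ∧ w ≤ 2 * y ^ (1 / n : ℝ) := by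
  have hroot : 1 ≤ y ^ (1 / n : ℝ) := Real.one_le_rpow hy (by positivity)
  refine ⟨⌈y ^ (1 / n : ℝ)⌉₊, Nat.ceil_pos.2 (by linarith), ?_, ?_⟩
  · calc y = (y ^ (1 / n : ℝ)) ^ n := by
          rw [one_div, Real.rpow_inv_natCast_pow (by linarith) hn]
      _ ≤ _ := pow_le_pow_left₀ (by linarith) (Nat.le_ceil _) n
  · linarith [Nat.ceil_lt_add_one (zero_le_one.trans hroot)]

lemma le_sq_mul_of_mul_le_mul_sqrt {A B N D : ℝ} (hA : 0 < A) (hN : 0 ≤ N) (hD : 0 ≤ D)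
    (h : A * N ≤ B * √(N * D)) : N ≤ (B / A) ^ 2 * D := by
  rcases hN.eq_or_lt with rfl | hN0
  · positivity
  have hsq : (A * N) ^ 2 ≤ B ^ 2 * (N * D) :=
    (pow_le_pow_left₀ (by positivity) h 2).trans_eq <| by
      rw [mul_pow, Real.sq_sqrt (by positivity)]
  have : N * (A ^ 2 * N) ≤ N * (B ^ 2 * D) := by linarith
  have := le_of_mul_le_mul_left this hN0
  rw [div_pow, div_mul_eq_mul_div, le_div_iff₀ (by positivity)]
  linarith

lemma le_of_forall_scale {n : ℕ} (hn : n ≠ 0) {A c₁ c₂ N D ε : ℝ} (hA : 0 < A) (hAc : A ≤ c₁)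
    (hc₂ : 0 ≤ c₂) (hN : 0 ≤ N) (hD : 1 ≤ D) (hε : 0 < ε) (hε1 : ε ≤ 1)
    (h : ∀ w : ℕ, 0 < w → A * ε * N ≤ N * D * (c₁ / w ^ n) + c₂ * w * √(N * D)) :
    N ≤ (4 * c₂ / A) ^ 2 * (2 * c₁ / A) ^ (2 / n : ℝ) * D ^ (1 + 2 / n : ℝ) *
      ε ^ (-(2 + 2 / n) : ℝ) := by
  have hc₁ : 0 < c₁ := hA.trans_le hAc
  have hD0 : 0 < D := by linarith
  set y := 2 * c₁ * D / (A * ε) with hy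
  have hy1 : 1 ≤ y := by
    rw [hy, one_le_div (by positivity)]
    calc A * ε ≤ A * 1 := by gcongr
      _ ≤ 2 * c₁ * 1 := by linarith
      _ ≤ 2 * c₁ * D := by gcongr
  obtain ⟨w, hw, hyw, hwy⟩ := exists_nat_le_pow_and_le_rpow hn hy1
  have hbias : N * D * (c₁ / w ^ n) ≤ A * ε / 2 * N :=
    calc N * D * (c₁ / w ^ n) ≤ N * D * (c₁ / y) := by gcongr
      _ = A * ε / 2 * N := by rw [hy]; field_simp
  have hfluct : A * ε / 2 * N ≤ c₂ * w * √(N * D) := by linarith [h w hw]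
  calc N ≤ (c₂ * w / (A * ε / 2)) ^ 2 * D :=
        le_sq_mul_of_mul_le_mul_sqrt (by positivity) hN hD0.le hfluct
    _ ≤ (c₂ * (2 * y ^ (1 / n : ℝ)) / (A * ε / 2)) ^ 2 * D := by gcongr
    _ = (4 * c₂ / A) ^ 2 * y ^ (2 / n : ℝ) * D * (ε ^ 2)⁻¹ := by
        have : (y ^ (1 / n : ℝ)) ^ 2 = y ^ (2 / n : ℝ) := by
          rw [← Real.rpow_natCast, ← Real.rpow_mul (by linarith)]
          congr 1
          push_cast
          ring
        rw [← this]
        field_simp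
        ring
    _ = _ := by
        rw [hy, show 2 * c₁ * D / (A * ε) = (2 * c₁ / A) * D * ε⁻¹ by field_simp,
          Real.mul_rpow (by positivity) (by positivity),
          Real.mul_rpow (by positivity) (by positivity), Real.rpow_add hD0, Real.rpow_one,
          Real.rpow_neg hε.le, Real.rpow_add hε, Real.inv_rpow hε.le, Real.rpow_two, mul_inv]
        ring

end scale

section norms

lemma norm2_le_l1 (v : Fin d → ℤ) : norm2 v ≤ l1 v := by
  rw [norm2, l1, Real.sqrt_le_left (by positivity)]
  push_cast
  simpa [Nat.cast_natAbs] using Finset.sum_sq_le_sq_sum_of_nonneg (s := Finset.univ)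
    (f := fun i => |(v i : ℝ)|) fun i _ => abs_nonneg _

lemma l1_le_mul_norm2 (v : Fin d → ℤ) : (l1 v : ℝ) ≤ d * norm2 v := by
  have hcoord (i) : ((v i).natAbs : ℝ) ≤ norm2 v := by
    rw [Nat.cast_natAbs, Int.cast_abs, ← Real.sqrt_sq_eq_abs]
    exact Real.sqrt_le_sqrt (Finset.single_le_sum (f := fun i => (v i : ℝ) ^ 2)
      (fun _ _ => sq_nonneg _) (Finset.mem_univ i))
  rw [l1, Nat.cast_sum]
  exact (Finset.sum_le_card_nsmul _ _ _ fun i _ => hcoord i).trans (by simp)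

end norms

section scale

lemma exists_mul_rpow_mul_exp_le (C : ℝ) {p q : ℝ} (hp : 0 ≤ p) (hq : 0 ≤ q) :
    ∃ K : ℝ, 0 < K ∧ ∀ V : ℝ, 2 ≤ V →
      C * V ^ p * Real.exp (-(K * Real.log V)) ≤ V ^ (-q) := by
  obtain ⟨m, hm⟩ := pow_unbounded_of_one_lt C (one_lt_two (α := ℝ))
  refine ⟨p + q + (m + 1 : ℕ), by positivity, fun V hV => ?_⟩
  have hV0 : 0 < V := by linarith
  have hC : C ≤ V ^ (m + 1) :=
    hm.le.trans <| (pow_le_pow_right₀ one_le_two m.le_succ).trans <|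
      pow_le_pow_left₀ zero_le_two hV _
  calc C * V ^ p * Real.exp (-((p + q + (m + 1 : ℕ)) * Real.log V))
      = C * V ^ p * V ^ (-(p + q + (m + 1 : ℕ))) := by
        rw [Real.rpow_def_of_pos hV0 (-_)]
        ring_nf
    _ ≤ V ^ (m + 1) * V ^ p * V ^ (-(p + q + (m + 1 : ℕ))) := by gcongr
    _ = V ^ (-q) := by
        rw [← Real.rpow_natCast, ← Real.rpow_add hV0, ← Real.rpow_add hV0]
        ring_nf

lemma exists_nat_scale {K : ℝ} (hK : 0 < K) {L₀ : ℝ} (hL₀ : 0 < L₀) :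
    ∃ K' : ℝ, 0 < K' ∧ ∀ L : ℝ, L₀ ≤ L → ∃ R : ℕ, 0 < R ∧ K * L ≤ R ∧ R ≤ K' * L := by
  refine ⟨K + 1 / L₀, by positivity, fun L hL => ?_⟩
  have hL0 : 0 < L := hL₀.trans_le hL
  refine ⟨⌈K * L⌉₊, Nat.ceil_pos.2 (by positivity), Nat.le_ceil _, ?_⟩
  have hceil := Nat.ceil_lt_add_one (show 0 ≤ K * L by positivity)
  have : 1 ≤ 1 / L₀ * L := by rwa [one_div_mul_eq_div, one_le_div hL₀]
  linarith

lemma exists_forall_mul_log_le (K : ℝ) : ∃ V₀ : ℝ, ∀ V, V₀ ≤ V → K * Real.log V ≤ V := by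
  have := (Real.isLittleO_log_id_atTop.const_mul_left K).bound one_pos
  obtain ⟨V₀, hV₀⟩ := Filter.eventually_atTop.1 (this.and (Filter.eventually_ge_atTop 0))
  refine ⟨V₀, fun V hV => (le_abs_self _).trans ?_⟩
  simpa [abs_of_nonneg (hV₀ V hV).2] using (hV₀ V hV).1

lemma one_le_log_two_rpow_neg_mul {V κ : ℝ} (hV : 2 ≤ V) (hκ : 0 ≤ κ) :
    1 ≤ Real.log 2 ^ (-κ) * Real.log V ^ κ := by
  have hlog2 : 0 < Real.log 2 := Real.log_pos one_lt_two
  rw [Real.rpow_neg hlog2.le, inv_mul_eq_div, one_le_div (by positivity)]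
  gcongr

end scale

section count

variable {G : Measure ℝ} [IsProbabilityMeasure G] [NullSingletonClass G] {a b α : ℝ}

lemma exists_small_left_mass (hab : a < b) (hsupp : ∀ᵐ x ∂G, x ∈ Set.Icc a b)
    {δ : ℝ} (hδ : 0 < δ) :
    ∃ η : ℝ, 0 < η ∧ 2 * η ≤ b - a ∧ G.real (Set.Iio (a + 2 * η)) ≤ δ := by
  have hzero : ProbabilityTheory.cdf G a = 0 := by
    rw [ProbabilityTheory.cdf_eq_real, measureReal_def, measure_congr Iio_ae_eq_Iic.symm]
    have : G (Set.Iio a) = 0 := measure_mono_null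
      (show Set.Iio a ⊆ {x | x ∉ Set.Icc a b} from fun _ hx h => (Set.mem_Iio.1 hx).not_ge h.1)
      (ae_iff.1 hsupp)
    simp [this]
  have hcont : ∀ᶠ x in nhdsWithin a (Set.Ioi a), ProbabilityTheory.cdf G x < δ :=
    ((ProbabilityTheory.cdf G).right_continuous a).mono Set.Ioi_subset_Ici_self
      |>.eventually_lt_const (hzero.trans_lt hδ)
  obtain ⟨x, hx, hxa, hxb⟩ := (hcont.and (Ioc_mem_nhdsGT hab)).exists
  refine ⟨(x - a) / 2, by linarith, by linarith, ?_⟩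
  rw [mul_div_cancel₀ _ two_ne_zero, add_sub_cancel]
  refine le_trans ?_ hx.le
  rw [ProbabilityTheory.cdf_eq_real]
  exact measureReal_mono Set.Iio_subset_Iic_self

lemma exists_measureReal_manyLowEdges_le (hd : 0 < d) (ha : 0 < a) (hab : a < b)
    (hsupp : ∀ᵐ x ∂G, x ∈ Set.Icc a b) {q : ℝ} (hq : 0 ≤ q) :
    ∃ η K : ℝ, 0 < η ∧ 2 * η ≤ b - a ∧ 0 < K ∧ ∀ v : Fin d → ℤ, 2 ≤ norm2 v → ∀ R : ℕ,
      K * Real.log (norm2 v) ≤ R →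
        (envMeasure d G).real (manyLowEdges d ⌈b / a * l1 v⌉₊ R (a + 2 * η)) ≤
          norm2 v ^ (-q) / 2 := by
  have hd0 : (1 : ℝ) ≤ d := mod_cast hd
  have hb : 0 < b := ha.trans hab
  set θ : ℝ := Real.exp (-1) / (4 * d) with hθ
  have hθ1 : θ ≤ 1 := by
    rw [hθ, div_le_one (by positivity)]
    linarith [Real.exp_le_one_iff.2 (show (-1 : ℝ) ≤ 0 by norm_num)]
  obtain ⟨η, hη, hηab, hηG⟩ := exists_small_left_mass hab hsupp (show 0 < θ ^ 2 by positivity)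
  set c := 2 * (b / a * d) + 3 with hc
  obtain ⟨K, hK, hKV⟩ := exists_mul_rpow_mul_exp_le (2 * c ^ d) d.cast_nonneg hq
  refine ⟨η, K, hη, hηab, hK, fun v hv R hR => ?_⟩
  set V := norm2 v
  have hB : 2 * (⌈b / a * l1 v⌉₊ : ℝ) + 1 ≤ c * V := by
    have hceil := Nat.ceil_lt_add_one (show 0 ≤ b / a * l1 v by positivity)
    have : b / a * l1 v ≤ b / a * (d * V) := by
      gcongr
      exact l1_le_mul_norm2 v
    have : c * V = 2 * (b / a * (d * V)) + 3 * V := by rw [hc]; ring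
    linarith
  calc _ ≤ (2 * (⌈b / a * l1 v⌉₊ : ℝ) + 1) ^ d * (4 * d * θ) ^ R :=
        measureReal_manyLowEdges_le (by positivity) hθ1 hηG _ R
    _ = (2 * (⌈b / a * l1 v⌉₊ : ℝ) + 1) ^ d * Real.exp (-R) := by
        rw [hθ, mul_div_cancel₀ _ (by positivity), ← Real.exp_nat_mul, mul_neg_one]
    _ ≤ (c * V) ^ d * Real.exp (-(K * Real.log V)) := by gcongr
    _ = 2 * c ^ d * V ^ (d : ℝ) * Real.exp (-(K * Real.log V)) / 2 := by
        rw [Real.rpow_natCast, mul_pow]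
        ring
    _ ≤ V ^ (-q) / 2 := by
        gcongr
        exact hKV V hv

end count

section counting

lemma two_lt_two_mul_div (hd : 2 ≤ d) : (2 : ℝ) < 2 * d / (d - 1) := by
  have hd2 : (2 : ℝ) ≤ d := mod_cast hd
  rw [lt_div_iff₀ (by linarith)]
  linarith

lemma two_mul_div_sub_one (hd : 2 ≤ d) : (2 * d / (d - 1) - 1 : ℝ) = (d + 1) / (d - 1) := by
  have hd2 : (2 : ℝ) ≤ d := mod_cast hd
  rw [div_sub_one (by linarith)]
  ring

variable {G : Measure ℝ} [IsProbabilityMeasure G] [NullSingletonClass G] {a b α γ : ℝ}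

lemma exists_card_le_mul_rpow (hd : 2 ≤ d) (hγ : γ = 2 * d / (d - 1))
    (hG : HasUniformComponent G a b α) {η : ℝ} (hη : 0 < η) (hηab : 2 * η ≤ b - a) :
    ∃ C : ℝ, 0 ≤ C ∧ ∀ (v : Fin d → ℤ) (R B : ℕ), 0 < R → R ≤ l1 v → b / a * l1 v ≤ B →
      ∀ ε : ℝ, 0 < ε → ε ≤ 1 →
        (envMeasure d G).real (manyLowEdges d B R (a + 2 * η)) ≤ ε / 2 →
          ∀ E : Finset (Edge d), (∀ e ∈ E, ε ≤ (envMeasure d G).real {t | e ∈ geodesic t 0 v}) →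
            E.card ≤ C * (((2 * R + 1) ^ d * (2 * d) : ℕ) : ℝ) ^ (γ - 1) * ε ^ (-γ) := by
  have hn : (((d - 1 : ℕ) : ℝ)) = d - 1 := by rw [Nat.cast_sub (by omega), Nat.cast_one]
  have hd1 : (0 : ℝ) < d - 1 := by rw [← hn]; exact mod_cast (by omega : 0 < d - 1)
  have hγ2 : γ = 2 + 2 / (d - 1 : ℕ) := by rw [hγ, hn]; field_simp; ring
  have hA : 0 < α * η ^ 2 / 8 := by have := hG.mass_pos; positivity
  have hb : 0 < b := hG.pos.trans hG.lt
  set A := α * η ^ 2 / 8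
  set c₀ := (b - a) * (b / a * (2 * (d + 1)) + 1)
  have hc₀ : 0 ≤ c₀ := by have := hG.pos; have := sub_nonneg.2 hG.lt.le; positivity
  set c₁ := max A c₀
  refine ⟨(4 * (2 * b * d) / A) ^ 2 * (2 * c₁ / A) ^ (2 / (d - 1 : ℕ) : ℝ), by positivity,
    fun v R B hR hRv hB ε hε hε1 hlow E hE => ?_⟩
  set D := (2 * R + 1) ^ d * (2 * d)
  have hD1 : 1 ≤ D := Nat.one_le_iff_ne_zero.2 (by positivity)
  have hcard : ((thickening E R).card : ℝ) ≤ E.card * D := mod_cast card_thickening_le E R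
  rw [show γ - 1 = 1 + 2 / (d - 1 : ℕ) by rw [hγ2]; ring, hγ2]
  refine le_of_forall_scale (by omega) hA (le_max_left _ _) (by positivity) (Nat.cast_nonneg _)
    (mod_cast hD1) hε hε1 fun w hw => ?_
  have hbias : c₀ * w / w ^ d ≤ c₁ / w ^ (d - 1) := by
    rw [← pow_sub_one_mul (by omega : d ≠ 0), mul_div_mul_right _ _ (by positivity)]
    gcongr
    exact le_max_right _ _
  calc A * ε * E.card ≤ _ := mul_card_le_of_le_measureReal hG hη.le hηab v hR hRv hB hlow hE hw
    _ ≤ _ := by gcongr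

lemma exists_card_le_of_le_norm2 (hd : 2 ≤ d) (hγ : γ = 2 * d / (d - 1))
    (hG : HasUniformComponent G a b α) {q : ℝ} (hq : 0 ≤ q) :
    ∃ C V₀ : ℝ, 0 ≤ C ∧ ∀ v : Fin d → ℤ, 2 ≤ norm2 v → V₀ ≤ norm2 v →
      ∀ ε : ℝ, norm2 v ^ (-q) ≤ ε → ε ≤ 1 →
        ∀ E : Finset (Edge d), (∀ e ∈ E, ε ≤ (envMeasure d G).real {t | e ∈ geodesic t 0 v}) →
          E.card ≤ C * ε ^ (-γ) * Real.log (norm2 v) ^ (d * (γ - 1)) := by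
  have hγ1 : 0 ≤ γ - 1 := by linarith [two_lt_two_mul_div hd]
  have hlog2 : 0 < Real.log 2 := Real.log_pos one_lt_two
  obtain ⟨η, K, hη, hηab, hK, hlow⟩ :=
    exists_measureReal_manyLowEdges_le (by omega : 0 < d) hG.pos hG.lt hG.ae_mem hq
  obtain ⟨C, hC, hcard⟩ := exists_card_le_mul_rpow hd hγ hG hη hηab
  obtain ⟨K', hK', hR⟩ := exists_nat_scale hK hlog2
  obtain ⟨V₀, hV₀⟩ := exists_forall_mul_log_le K'
  refine ⟨C * ((3 * K') ^ d * (2 * d)) ^ (γ - 1), V₀, by positivity,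
    fun v hv hv₀ ε hε hε1 E hE => ?_⟩
  set L := Real.log (norm2 v)
  have hL : Real.log 2 ≤ L := Real.log_le_log two_pos hv
  have hL0 : 0 < L := hlog2.trans_le hL
  have hε0 : 0 < ε := (Real.rpow_pos_of_pos (by linarith) _).trans_le hε
  obtain ⟨R, hR0, hKR, hRK⟩ := hR L hL
  have hR1 : (1 : ℝ) ≤ R := mod_cast hR0
  have hRv : R ≤ l1 v := by
    exact_mod_cast hRK.trans ((hV₀ _ hv₀).trans (norm2_le_l1 v))
  have hvolume : (((2 * R + 1) ^ d * (2 * d) : ℕ) : ℝ) ≤ (3 * K') ^ d * (2 * d) * L ^ (d : ℝ) := by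
    push_cast
    calc (2 * R + 1 : ℝ) ^ d * (2 * d) ≤ (3 * (K' * L)) ^ d * (2 * d) := by gcongr; linarith
      _ = _ := by rw [Real.rpow_natCast, ← mul_assoc 3, mul_pow (3 * K')]; ring
  have hrare := (hlow v hv R hKR).trans (div_le_div_of_nonneg_right hε zero_le_two)
  calc (E.card : ℝ)
      ≤ C * (((2 * R + 1) ^ d * (2 * d) : ℕ) : ℝ) ^ (γ - 1) * ε ^ (-γ) :=
        hcard v R _ hR0 hRv (Nat.le_ceil _) ε hε0 hε1 hrare E hE
    _ ≤ C * ((3 * K') ^ d * (2 * d) * L ^ (d : ℝ)) ^ (γ - 1) * ε ^ (-γ) := by gcongr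
    _ = _ := by
        rw [Real.mul_rpow (by positivity) (by positivity), ← Real.rpow_mul hL0.le]
        ring

lemma exists_card_le_of_norm2_le (hG : HasUniformComponent G a b α) (hγ : 1 ≤ γ)
    {κ : ℝ} (hκ : 0 ≤ κ) (V₀ : ℝ) :
    ∃ C : ℝ, 0 ≤ C ∧ ∀ v : Fin d → ℤ, 2 ≤ norm2 v → norm2 v ≤ V₀ → ∀ ε : ℝ, 0 < ε → ε ≤ 1 →
      ∀ E : Finset (Edge d), (∀ e ∈ E, ε ≤ (envMeasure d G).real {t | e ∈ geodesic t 0 v}) →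
        E.card ≤ C * ε ^ (-γ) * Real.log (norm2 v) ^ κ := by
  have : 0 < Real.log 2 := Real.log_pos one_lt_two
  have hb_a : 0 ≤ b / a := div_nonneg (hG.pos.trans hG.lt).le hG.pos.le
  refine ⟨b / a * (d * |V₀|) * Real.log 2 ^ (-κ), by positivity,
    fun v hv hv₀ ε hε hε1 E hE => ?_⟩
  have hcard : E.card * ε ≤ b / a * (d * |V₀|) :=
    calc E.card * ε ≤ ∑ e ∈ E, (envMeasure d G).real {t | e ∈ geodesic t 0 v} := by
          rw [← nsmul_eq_mul]
          exact Finset.card_nsmul_le_sum _ _ _ hE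
      _ ≤ b / a * l1 (v - 0) := sum_measureReal_le_mul_l1 hG.pos hG.ae_mem 0 v E
      _ ≤ b / a * (d * |V₀|) := by
          rw [sub_zero]
          gcongr
          exact (l1_le_mul_norm2 v).trans (by gcongr; exact hv₀.trans (le_abs_self _))
  calc (E.card : ℝ) ≤ b / a * (d * |V₀|) * ε ^ (-1 : ℝ) * 1 := by
        rwa [mul_one, Real.rpow_neg_one, ← div_eq_mul_inv, le_div_iff₀ hε]
    _ ≤ b / a * (d * |V₀|) * ε ^ (-γ) * (Real.log 2 ^ (-κ) * Real.log (norm2 v) ^ κ) := by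
        gcongr ?_ * ?_
        · gcongr _ * ?_
          exact Real.rpow_le_rpow_of_exponent_ge hε hε1 (neg_le_neg hγ)
        · exact one_le_log_two_rpow_neg_mul hv hκ
    _ = _ := by ring

end counting

/-! ### Dyadic summation -/

section dyadic

variable {ι : Type*}

lemma rpow_le_add_sum_dyadic {x β : ℝ} (hx0 : 0 ≤ x) (hx1 : x ≤ 1) (hβ : 1 ≤ β) (m : ℕ) :
    x ^ β ≤ x * ((1 / 2) ^ m) ^ (β - 1) +
      ∑ j ∈ Finset.range m, if (1 / 2) ^ (j + 1) ≤ x then ((1 / 2) ^ j) ^ β else 0 := by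
  have hterm (j : ℕ) : 0 ≤ if (1 / 2 : ℝ) ^ (j + 1) ≤ x then ((1 / 2 : ℝ) ^ j) ^ β else 0 := by
    split_ifs <;> positivity
  have hsum := Finset.sum_nonneg fun j (_ : j ∈ Finset.range m) => hterm j
  rcases hx0.eq_or_lt with rfl | hx
  · rw [Real.zero_rpow (by linarith), zero_mul, zero_add]
    exact hsum
  obtain ⟨n, hnx, hxn⟩ := exists_nat_pow_near_of_lt_one hx hx1
    (show (0 : ℝ) < 1 / 2 by norm_num) (by norm_num)
  rcases lt_or_ge n m with hnm | hmn
  · calc x ^ β ≤ ((1 / 2) ^ n) ^ β := Real.rpow_le_rpow hx0 hxn (by linarith)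
      _ = if (1 / 2) ^ (n + 1) ≤ x then ((1 / 2) ^ n) ^ β else 0 := (if_pos hnx.le).symm
      _ ≤ _ := Finset.single_le_sum (fun j _ => hterm j) (Finset.mem_range.2 hnm)
      _ ≤ _ := le_add_of_nonneg_left (by positivity)
  · calc x ^ β = x * x ^ (β - 1) := by rw [← Real.rpow_one_add' hx0 (by linarith), add_sub_cancel]
      _ ≤ x * ((1 / 2) ^ m) ^ (β - 1) := by
          have := hxn.trans (pow_le_pow_of_le_one (by norm_num) (by norm_num) hmn)
          gcongr
      _ ≤ _ := le_add_of_nonneg_right hsum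

lemma half_pow_rpow (n : ℕ) (x : ℝ) : ((1 / 2 : ℝ) ^ n) ^ x = 2 ^ (-(n * x)) := by
  rw [← Real.rpow_natCast, ← Real.rpow_mul (by norm_num), one_div, Real.inv_rpow zero_le_two,
    Real.rpow_neg zero_le_two]

lemma exists_dyadic_near {τ : ℝ} (hτ : 0 < τ) :
    ∃ m : ℕ, (1 / 2 : ℝ) ^ m ≤ 2 * τ ∧ (m ≠ 0 → τ ≤ (1 / 2) ^ m) := by
  rcases le_or_gt τ 1 with hτ1 | hτ1
  · obtain ⟨m, hm, hτm⟩ := exists_nat_pow_near_of_lt_one hτ hτ1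
      (show (0 : ℝ) < 1 / 2 by norm_num) (by norm_num)
    rw [pow_succ] at hm
    exact ⟨m, by linarith, fun _ => hτm⟩
  · exact ⟨0, by rw [pow_zero]; linarith, fun h => absurd rfl h⟩

lemma sum_two_rpow_pow_le {κ τ : ℝ} (hκ : 0 < κ) (hτ : 0 < τ) {m : ℕ}
    (hm : m ≠ 0 → τ ≤ (1 / 2) ^ m) :
    ∑ j ∈ Finset.range m, ((2 : ℝ) ^ κ) ^ j ≤ τ ^ (-κ) / (2 ^ κ - 1) := by
  have hratio : 1 < (2 : ℝ) ^ κ := Real.one_lt_rpow one_lt_two hκ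
  rcases eq_or_ne m 0 with rfl | hm0
  · rw [Finset.sum_range_zero]
    exact div_nonneg (by positivity) (sub_nonneg.2 hratio.le)
  rw [geom_sum_eq hratio.ne']
  gcongr
  calc ((2 : ℝ) ^ κ) ^ m - 1 ≤ ((2 : ℝ) ^ κ) ^ m := by linarith
    _ = ((1 / 2) ^ m) ^ (-κ) := by
        rw [half_pow_rpow, ← Real.rpow_natCast, ← Real.rpow_mul zero_le_two]
        ring_nf
    _ ≤ τ ^ (-κ) := Real.rpow_le_rpow_of_nonpos hτ (hm hm0) (by linarith)

lemma inv_le_log {V : ℝ} (hV : 2 ≤ V) : V⁻¹ ≤ Real.log V := by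
  have hinv : V⁻¹ ≤ 2⁻¹ := inv_anti₀ two_pos hV
  have hlog : Real.log 2 ≤ Real.log V := Real.log_le_log two_pos hV
  linarith [Real.log_two_gt_d9]

lemma mul_rpow_rpow_eq {V β γ : ℝ} (hV : 0 < V) (hγ : 1 < γ) :
    V * (V ^ (-(1 / (γ - 1)))) ^ (β - 1) = V ^ ((γ - β) / (γ - 1)) := by
  have hγ1 : γ - 1 ≠ 0 := (sub_pos.2 hγ).ne'
  rw [← Real.rpow_mul hV.le]
  nth_rw 1 [← Real.rpow_one V]
  rw [← Real.rpow_add hV]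
  congr 1
  field_simp
  ring

/-- A family of numbers in `[0, 1]` whose sum is of order `V`, while at most
`ε ^ (-γ) * (log V) ^ (δ * (γ - 1))` of its members, up to the constant `C`, reach a given
level `ε`. The lower cutoff on `ε` is a power of `V` lying below the levels
`(log V) ^ δ * V ^ (-1 / (γ - 1))` and `V ^ (-1 / (γ - 1))` at which the two bounds balance. -/
structure IsSparse (γ δ C V : ℝ) (p : ι → ℝ) : Prop where
  nonneg : ∀ i, 0 ≤ p i
  le_one : ∀ i, p i ≤ 1
  sum_le : ∀ S : Finset ι, ∑ i ∈ S, p i ≤ C * V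
  card_le : ∀ ε : ℝ, V ^ (-(δ + 1 / (γ - 1))) ≤ ε → ε ≤ 1 → ∀ E : Finset ι, (∀ i ∈ E, ε ≤ p i) →
    E.card ≤ C * ε ^ (-γ) * Real.log V ^ (δ * (γ - 1))

namespace IsSparse

variable {γ δ C V β : ℝ} {p : ι → ℝ}

lemma sum_rpow_le_add_sum (h : IsSparse γ δ C V p) (hβ : 1 ≤ β) {m : ℕ}
    (hm : m ≠ 0 → V ^ (-(δ + 1 / (γ - 1))) ≤ (1 / 2) ^ m) (S : Finset ι) :
    ∑ i ∈ S, p i ^ β ≤ C * V * ((1 / 2) ^ m) ^ (β - 1) +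
      C * 2 ^ γ * Real.log V ^ (δ * (γ - 1)) *
        ∑ j ∈ Finset.range m, ((2 : ℝ) ^ (γ - β)) ^ j := by
  have hlevel : ∀ j ∈ Finset.range m,
      ∑ i ∈ S, (if (1 / 2) ^ (j + 1) ≤ p i then ((1 / 2 : ℝ) ^ j) ^ β else 0) ≤
        C * 2 ^ γ * Real.log V ^ (δ * (γ - 1)) * ((2 : ℝ) ^ (γ - β)) ^ j := by
    intro j hj
    have hjm : j + 1 ≤ m := Finset.mem_range.1 hj
    have hcard := h.card_le ((1 / 2) ^ (j + 1))
      ((hm (by omega)).trans (pow_le_pow_of_le_one (by norm_num) (by norm_num) hjm))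
      (pow_le_one₀ (by norm_num) (by norm_num)) {i ∈ S | (1 / 2) ^ (j + 1) ≤ p i}
      fun i hi => (Finset.mem_filter.1 hi).2
    calc _ = ({i ∈ S | (1 / 2) ^ (j + 1) ≤ p i}.card : ℝ) * ((1 / 2) ^ j) ^ β := by
          rw [← Finset.sum_filter, Finset.sum_const, nsmul_eq_mul]
      _ ≤ C * ((1 / 2) ^ (j + 1)) ^ (-γ) * Real.log V ^ (δ * (γ - 1)) * ((1 / 2) ^ j) ^ β := by
          gcongr
      _ = C * Real.log V ^ (δ * (γ - 1)) *
            (((1 / 2) ^ (j + 1)) ^ (-γ) * ((1 / 2) ^ j) ^ β) := by ring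
      _ = C * Real.log V ^ (δ * (γ - 1)) * (2 ^ γ * ((2 : ℝ) ^ (γ - β)) ^ j) := by
          rw [half_pow_rpow, half_pow_rpow, ← Real.rpow_natCast (2 ^ (γ - β)),
            ← Real.rpow_mul zero_le_two, ← Real.rpow_add two_pos, ← Real.rpow_add two_pos]
          push_cast
          ring_nf
      _ = _ := by ring
  calc ∑ i ∈ S, p i ^ β
      ≤ ∑ i ∈ S, (p i * ((1 / 2) ^ m) ^ (β - 1) + ∑ j ∈ Finset.range m,
          if (1 / 2) ^ (j + 1) ≤ p i then ((1 / 2) ^ j) ^ β else 0) :=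
        Finset.sum_le_sum fun i _ => rpow_le_add_sum_dyadic (h.nonneg i) (h.le_one i) hβ m
    _ ≤ _ := by
        rw [Finset.sum_add_distrib, ← Finset.sum_mul, Finset.sum_comm, Finset.mul_sum]
        gcongr with j hj
        · exact h.sum_le S
        · exact hlevel j hj

lemma exists_sum_rpow_le (h : IsSparse γ δ C V p) (hC : 0 ≤ C) (hV : 0 ≤ V) (hβ : 1 ≤ β)
    {τ : ℝ} (hτ0 : 0 < τ) (hτ : V ^ (-(δ + 1 / (γ - 1))) ≤ τ) (S : Finset ι) :
    ∃ m : ℕ, (m ≠ 0 → τ ≤ (1 / 2) ^ m) ∧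
      ∑ i ∈ S, p i ^ β ≤ C * 2 ^ (β - 1) * (V * τ ^ (β - 1)) +
        C * 2 ^ γ * (Real.log V ^ (δ * (γ - 1)) *
          ∑ j ∈ Finset.range m, ((2 : ℝ) ^ (γ - β)) ^ j) := by
  obtain ⟨m, hmτ, hτm⟩ := exists_dyadic_near hτ0
  refine ⟨m, hτm, (h.sum_rpow_le_add_sum hβ (fun hm => hτ.trans (hτm hm)) S).trans ?_⟩
  rw [mul_assoc (C * 2 ^ γ)]
  refine add_le_add_left ?_ _
  calc C * V * ((1 / 2) ^ m) ^ (β - 1) ≤ C * V * (2 * τ) ^ (β - 1) := by gcongr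
    _ = _ := by rw [Real.mul_rpow zero_le_two hτ0.le]; ring

lemma exists_sum_rpow_le_of_lt (hγ : 1 < γ) (hδ : 0 ≤ δ) (hC : 0 < C) (hβ : 1 ≤ β) (hβγ : β < γ) :
    ∃ C' : ℝ, 0 < C' ∧ ∀ (V : ℝ) (p : ι → ℝ), 2 ≤ V → IsSparse γ δ C V p → ∀ S : Finset ι,
      ∑ i ∈ S, p i ^ β ≤ C' * (V ^ ((γ - β) / (γ - 1)) * Real.log V ^ (δ * (β - 1))) := by
  have : 0 < γ - 1 := sub_pos.2 hγ
  have hratio : 0 < (2 : ℝ) ^ (γ - β) - 1 :=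
    sub_pos.2 (Real.one_lt_rpow one_lt_two (sub_pos.2 hβγ))
  refine ⟨C * 2 ^ (β - 1) + C * 2 ^ γ / (2 ^ (γ - β) - 1), by positivity, fun V p hV h S => ?_⟩
  have hV0 : 0 < V := by linarith
  have hL : 0 < Real.log V := Real.log_pos (by linarith)
  set L := Real.log V
  set τ := L ^ δ * V ^ (-(1 / (γ - 1))) with hτ
  have hcutoff : V ^ (-(δ + 1 / (γ - 1))) ≤ τ := by
    rw [neg_add, Real.rpow_add hV0, Real.rpow_neg hV0.le, ← Real.inv_rpow hV0.le, hτ]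
    gcongr
    exact inv_le_log hV
  have hlow : V * τ ^ (β - 1) = V ^ ((γ - β) / (γ - 1)) * L ^ (δ * (β - 1)) := by
    rw [hτ, Real.mul_rpow (by positivity) (by positivity), ← Real.rpow_mul hL.le, mul_left_comm,
      mul_rpow_rpow_eq hV0 hγ, mul_comm]
  have hhigh : L ^ (δ * (γ - 1)) * τ ^ (-(γ - β)) =
      V ^ ((γ - β) / (γ - 1)) * L ^ (δ * (β - 1)) := by
    rw [hτ, Real.mul_rpow (by positivity) (by positivity), ← Real.rpow_mul hL.le,
      ← Real.rpow_mul hV0.le, ← mul_assoc, ← Real.rpow_add hL, mul_comm]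
    ring_nf
  obtain ⟨m, hm, hsum⟩ := h.exists_sum_rpow_le hC.le hV0.le hβ (by positivity) hcutoff S
  calc ∑ i ∈ S, p i ^ β ≤ _ := hsum
    _ ≤ C * 2 ^ (β - 1) * (V * τ ^ (β - 1)) +
          C * 2 ^ γ * (L ^ (δ * (γ - 1)) * (τ ^ (-(γ - β)) / (2 ^ (γ - β) - 1))) := by
        gcongr
        exact sum_two_rpow_pow_le (sub_pos.2 hβγ) (by positivity) hm
    _ = _ := by rw [← mul_div_assoc, hlow, hhigh]; ring

lemma exists_sum_rpow_le_of_ge (h : IsSparse γ δ C V p) (hγ : 1 < γ) (hδ : 0 ≤ δ) (hC : 0 ≤ C)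
    (hV : 2 ≤ V) (hβγ : γ ≤ β) (S : Finset ι) :
    ∃ m : ℕ, m ≤ Real.log V / ((γ - 1) * Real.log 2) ∧
      ∑ i ∈ S, p i ^ β ≤ C * 2 ^ (β - 1) + C * 2 ^ γ * (Real.log V ^ (δ * (γ - 1)) *
        ∑ j ∈ Finset.range m, ((2 : ℝ) ^ (γ - β)) ^ j) := by
  have hγ1 : 0 < γ - 1 := sub_pos.2 hγ
  have hV0 : 0 < V := by linarith
  have hL : 0 < Real.log V := Real.log_pos (by linarith)
  have hlog2 : 0 < Real.log 2 := Real.log_pos one_lt_two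
  set τ := V ^ (-(1 / (γ - 1))) with hτ
  have hτ0 : 0 < τ := Real.rpow_pos_of_pos hV0 _
  have hcutoff : V ^ (-(δ + 1 / (γ - 1))) ≤ τ :=
    Real.rpow_le_rpow_of_exponent_le (by linarith) (by linarith)
  obtain ⟨m, hm, hsum⟩ := h.exists_sum_rpow_le (β := β) hC hV0.le (by linarith) hτ0 hcutoff S
  refine ⟨m, ?_, hsum.trans (add_le_add_left (mul_le_of_le_one_right (by positivity) ?_) _)⟩
  · rcases eq_or_ne m 0 with rfl | hm0
    · rw [Nat.cast_zero]
      positivity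
    · have hlog := Real.log_le_log hτ0 (hm hm0)
      rw [Real.log_rpow hV0, Real.log_pow, one_div (2 : ℝ), Real.log_inv] at hlog
      rw [← div_div, le_div_iff₀ hlog2, ← one_div_mul_eq_div]
      linarith
  · rw [hτ, mul_rpow_rpow_eq hV0 hγ]
    exact Real.rpow_le_one_of_one_le_of_nonpos (by linarith)
      (div_nonpos_of_nonpos_of_nonneg (by linarith) hγ1.le)

lemma exists_sum_rpow_le_of_eq (hγ : 1 < γ) (hδ : 0 ≤ δ) (hC : 0 < C) :
    ∃ C' : ℝ, 0 < C' ∧ ∀ (V : ℝ) (p : ι → ℝ), 2 ≤ V → IsSparse γ δ C V p → ∀ S : Finset ι,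
      ∑ i ∈ S, p i ^ γ ≤ C' * Real.log V ^ (δ * (γ - 1) + 1) := by
  have : 0 < γ - 1 := sub_pos.2 hγ
  have : 0 < Real.log 2 := Real.log_pos one_lt_two
  set κ := δ * (γ - 1) + 1 with hκ
  refine ⟨C * 2 ^ (γ - 1) * Real.log 2 ^ (-κ) + C * 2 ^ γ / ((γ - 1) * Real.log 2),
    by positivity, fun V p hV h S => ?_⟩
  have hL : 0 < Real.log V := Real.log_pos (by linarith)
  obtain ⟨m, hm, hsum⟩ := h.exists_sum_rpow_le_of_ge hγ hδ hC.le hV le_rfl S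
  have hgeom : ∑ j ∈ Finset.range m, ((2 : ℝ) ^ (γ - γ)) ^ j = m := by simp
  calc ∑ i ∈ S, p i ^ γ ≤ _ := hsum
    _ ≤ C * 2 ^ (γ - 1) * (Real.log 2 ^ (-κ) * Real.log V ^ κ) +
          C * 2 ^ γ * (Real.log V ^ (δ * (γ - 1)) * (Real.log V / ((γ - 1) * Real.log 2))) := by
        rw [hgeom]
        refine add_le_add (le_mul_of_one_le_right (by positivity) ?_) (by gcongr)
        exact one_le_log_two_rpow_neg_mul hV (by positivity)
    _ = _ := by rw [hκ, Real.rpow_add hL, Real.rpow_one]; ring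

lemma exists_sum_rpow_le_of_gt (hγ : 1 < γ) (hδ : 0 ≤ δ) (hC : 0 < C) (hβγ : γ < β) :
    ∃ C' : ℝ, 0 < C' ∧ ∀ (V : ℝ) (p : ι → ℝ), 2 ≤ V → IsSparse γ δ C V p → ∀ S : Finset ι,
      ∑ i ∈ S, p i ^ β ≤ C' * Real.log V ^ (δ * (γ - 1)) := by
  have : 0 < γ - 1 := sub_pos.2 hγ
  have : 0 < Real.log 2 := Real.log_pos one_lt_two
  have hratio : (2 : ℝ) ^ (γ - β) < 1 :=
    Real.rpow_lt_one_of_one_lt_of_neg one_lt_two (by linarith)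
  set κ := δ * (γ - 1)
  refine ⟨C * 2 ^ (β - 1) * Real.log 2 ^ (-κ) + C * 2 ^ γ * (1 - 2 ^ (γ - β))⁻¹,
    by have := sub_pos.2 hratio; positivity, fun V p hV h S => ?_⟩
  have hL : 0 < Real.log V := Real.log_pos (by linarith)
  obtain ⟨m, -, hsum⟩ := h.exists_sum_rpow_le_of_ge hγ hδ hC.le hV hβγ.le S
  have hgeom : ∑ j ∈ Finset.range m, ((2 : ℝ) ^ (γ - β)) ^ j ≤ (1 - 2 ^ (γ - β))⁻¹ := by
    rw [← tsum_geometric_of_lt_one (by positivity) hratio]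
    exact (summable_geometric_of_lt_one (by positivity) hratio).sum_le_tsum _
      fun j _ => by positivity
  calc ∑ i ∈ S, p i ^ β ≤ _ := hsum
    _ ≤ C * 2 ^ (β - 1) * (Real.log 2 ^ (-κ) * Real.log V ^ κ) +
          C * 2 ^ γ * (Real.log V ^ κ * (1 - 2 ^ (γ - β))⁻¹) := by
        refine add_le_add (le_mul_of_one_le_right (by positivity) ?_) (by gcongr)
        exact one_le_log_two_rpow_neg_mul hV (by positivity)
    _ = _ := by ring

end IsSparse

end dyadic

section influence

variable {G : Measure ℝ} [IsProbabilityMeasure G]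

lemma tsum_influence_rpow_le {v : Fin d → ℤ} {β X : ℝ} (hβ : 0 ≤ β)
    (h : ∀ S : Finset (Edge d),
      ∑ e ∈ S, (envMeasure d G).real {t | e ∈ geodesic t 0 v} ^ β ≤ X) :
    ∑' e : Edge d, influence G v e ^ β ≤ ENNReal.ofReal X := by
  have hinfluence (e : Edge d) : influence G v e ^ β =
      ENNReal.ofReal ((envMeasure d G).real {t | e ∈ geodesic t 0 v} ^ β) := by
    rw [← ENNReal.ofReal_rpow_of_nonneg measureReal_nonneg hβ, ofReal_measureReal, influence]
  rw [ENNReal.tsum_eq_iSup_sum]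
  refine iSup_le fun S => ?_
  simp only [hinfluence]
  rw [← ENNReal.ofReal_sum_of_nonneg fun e _ => Real.rpow_nonneg measureReal_nonneg _]
  exact ENNReal.ofReal_le_ofReal (h S)

variable [NullSingletonClass G] {a b α β : ℝ}

lemma exists_isSparse_measureReal_mem_geodesic (hd : 2 ≤ d) (hG : HasUniformComponent G a b α)
    {γ : ℝ} (hγ : γ = 2 * d / (d - 1)) :
    ∃ C : ℝ, 0 < C ∧ ∀ v : Fin d → ℤ, 2 ≤ norm2 v →
      IsSparse γ d C (norm2 v) fun e => (envMeasure d G).real {t | e ∈ geodesic t 0 v} := by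
  have hγ1 : 0 < γ - 1 := by linarith [two_lt_two_mul_div hd]
  have ha := hG.pos
  have hb : 0 < b := ha.trans hG.lt
  obtain ⟨C₁, V₀, hC₁, hlarge⟩ :=
    exists_card_le_of_le_norm2 hd hγ hG (show 0 ≤ d + 1 / (γ - 1) by positivity)
  obtain ⟨C₂, hC₂, hsmall⟩ := exists_card_le_of_norm2_le (d := d) hG (sub_nonneg.1 hγ1.le)
    (show 0 ≤ d * (γ - 1) by positivity) V₀
  refine ⟨b / a * d + C₁ + C₂, by positivity, fun v hv =>
    ⟨fun e => measureReal_nonneg, fun e => measureReal_le_one, fun S => ?_,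
      fun ε hε hε1 E hE => ?_⟩⟩
  · calc _ ≤ b / a * l1 (v - 0) := sum_measureReal_le_mul_l1 hG.pos hG.ae_mem 0 v S
      _ ≤ b / a * (d * norm2 v) := by
          rw [sub_zero]
          gcongr
          exact l1_le_mul_norm2 v
      _ ≤ (b / a * d + C₁ + C₂) * norm2 v := by
          rw [← mul_assoc]
          gcongr
          linarith
  · have hε0 : 0 < ε := (Real.rpow_pos_of_pos (by linarith) _).trans_le hε
    have hL : 0 < Real.log (norm2 v) := Real.log_pos (by linarith)
    rcases le_total V₀ (norm2 v) with hV₀ | hV₀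
    · refine (hlarge v hv hV₀ ε hε hε1 E hE).trans ?_
      gcongr
      linarith [show 0 ≤ b / a * d by positivity]
    · refine (hsmall v hv hV₀ ε hε0 hε1 E hE).trans ?_
      gcongr
      linarith [show 0 ≤ b / a * d by positivity]

lemma exists_tsum_influence_rpow_le_of_lt (hd : 2 ≤ d) (hG : HasUniformComponent G a b α)
    (hβ : 1 ≤ β) (hβγ : β < 2 * d / (d - 1)) :
    ∃ C : ℝ, 0 < C ∧ ∀ v : Fin d → ℤ, 2 ≤ norm2 v →
      ∑' e : Edge d, influence G v e ^ β ≤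
        ENNReal.ofReal (C * (norm2 v ^ ((d - 1) / (d + 1) * (2 * d / (d - 1) - β) : ℝ) *
          Real.log (norm2 v) ^ ((β - 1) * d))) := by
  obtain ⟨K, hK, hsparse⟩ := exists_isSparse_measureReal_mem_geodesic hd hG rfl
  obtain ⟨C, hC, hsum⟩ := IsSparse.exists_sum_rpow_le_of_lt (ι := Edge d)
    (one_lt_two.trans (two_lt_two_mul_div hd)) d.cast_nonneg hK hβ hβγ
  refine ⟨C, hC, fun v hv => tsum_influence_rpow_le (by linarith) fun S => ?_⟩
  convert hsum _ _ hv (hsparse v hv) S using 4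
  · rw [two_mul_div_sub_one hd, div_div_eq_mul_div]
    ring
  · exact mul_comm _ _

lemma exists_tsum_influence_rpow_le_of_eq (hd : 2 ≤ d) (hG : HasUniformComponent G a b α)
    (hβγ : β = 2 * d / (d - 1)) :
    ∃ C : ℝ, 0 < C ∧ ∀ v : Fin d → ℤ, 2 ≤ norm2 v →
      ∑' e : Edge d, influence G v e ^ β ≤
        ENNReal.ofReal (C * Real.log (norm2 v) ^ (d * (d + 1) / (d - 1) + 1 : ℝ)) := by
  have hβ : 2 < β := hβγ ▸ two_lt_two_mul_div hd
  obtain ⟨K, hK, hsparse⟩ := exists_isSparse_measureReal_mem_geodesic hd hG hβγ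
  obtain ⟨C, hC, hsum⟩ := IsSparse.exists_sum_rpow_le_of_eq (ι := Edge d)
    (one_lt_two.trans hβ) d.cast_nonneg hK
  refine ⟨C, hC, fun v hv => tsum_influence_rpow_le (by linarith) fun S => ?_⟩
  rw [mul_div_assoc, ← two_mul_div_sub_one hd, ← hβγ]
  exact hsum _ _ hv (hsparse v hv) S

lemma exists_tsum_influence_rpow_le_of_gt (hd : 2 ≤ d) (hG : HasUniformComponent G a b α)
    (hβγ : 2 * d / (d - 1) < β) :
    ∃ C : ℝ, 0 < C ∧ ∀ v : Fin d → ℤ, 2 ≤ norm2 v →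
      ∑' e : Edge d, influence G v e ^ β ≤
        ENNReal.ofReal (C * Real.log (norm2 v) ^ (d * (d + 1) / (d - 1) : ℝ)) := by
  have hγ := two_lt_two_mul_div hd
  obtain ⟨K, hK, hsparse⟩ := exists_isSparse_measureReal_mem_geodesic hd hG rfl
  obtain ⟨C, hC, hsum⟩ := IsSparse.exists_sum_rpow_le_of_gt (ι := Edge d)
    (one_lt_two.trans hγ) d.cast_nonneg hK hβγ
  refine ⟨C, hC, fun v hv => tsum_influence_rpow_le (by linarith) fun S => ?_⟩
  rw [mul_div_assoc, ← two_mul_div_sub_one hd]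
  exact hsum _ _ hv (hsparse v hv) S

lemma exists_tsum_influence_sq_le (hd : 2 ≤ d) (hG : HasUniformComponent G a b α) :
    ∃ C : ℝ, 0 < C ∧ ∀ v : Fin d → ℤ, 2 ≤ norm2 v →
      ∑' e : Edge d, influence G v e ^ (2 : ℝ) ≤
        ENNReal.ofReal (C * (norm2 v ^ (2 / (d + 1) : ℝ) * Real.log (norm2 v) ^ (d : ℝ))) := by
  have hd2 : (2 : ℝ) ≤ d := mod_cast hd
  have hd1 : (d - 1 : ℝ) ≠ 0 := by linarith
  have hexponent : ((d - 1) / (d + 1) * (2 * d / (d - 1) - 2) : ℝ) = 2 / (d + 1) := by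
    field_simp
    ring
  obtain ⟨C, hC, hsum⟩ :=
    exists_tsum_influence_rpow_le_of_lt hd hG one_le_two (two_lt_two_mul_div hd)
  rw [hexponent, show ((2 - 1) * d : ℝ) = d by ring] at hsum
  exact ⟨C, hC, hsum⟩

end influence

end FPP

theorem corollary1p3_general (d : ℕ) (hd : 2 ≤ d) (G : Measure ℝ) [IsProbabilityMeasure G]
    [NullSingletonClass G] {a b α : ℝ} (hG : FPP.HasUniformComponent G a b α) :
    (∀ β : ℝ, 1 ≤ β → ∃ C : ℝ, 0 < C ∧ ∀ v : Fin d → ℤ, 2 ≤ FPP.norm2 v →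
      (β < 2 * d / (d - 1) →
        ∑' e : FPP.Edge d, FPP.influence G v e ^ β ≤
          ENNReal.ofReal (C *
            (FPP.norm2 v ^ (((d - 1) / (d + 1)) * (2 * d / (d - 1) - β) : ℝ) *
              Real.log (FPP.norm2 v) ^ ((β - 1) * d : ℝ)))) ∧
      (β = 2 * d / (d - 1) →
        ∑' e : FPP.Edge d, FPP.influence G v e ^ β ≤
          ENNReal.ofReal (C * Real.log (FPP.norm2 v) ^ (d * (d + 1) / (d - 1) + 1 : ℝ))) ∧
      (2 * d / (d - 1) < β →
        ∑' e : FPP.Edge d, FPP.influence G v e ^ β ≤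
          ENNReal.ofReal (C * Real.log (FPP.norm2 v) ^ (d * (d + 1) / (d - 1) : ℝ)))) ∧
    (∃ C : ℝ, 0 < C ∧ ∀ v : Fin d → ℤ, 2 ≤ FPP.norm2 v →
      ∑' e : FPP.Edge d, FPP.influence G v e ^ (2 : ℝ) ≤
        ENNReal.ofReal
          (C * (FPP.norm2 v ^ (2 / (d + 1) : ℝ) * Real.log (FPP.norm2 v) ^ (d : ℝ)))) := by
  refine ⟨fun β hβ => ?_, FPP.exists_tsum_influence_sq_le hd hG⟩
  rcases lt_trichotomy β (2 * d / (d - 1)) with hlt | heq | hgt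
  · obtain ⟨C, hC, hsum⟩ := FPP.exists_tsum_influence_rpow_le_of_lt hd hG hβ hlt
    exact ⟨C, hC, fun v hv =>
      ⟨fun _ => hsum v hv, fun heq => absurd heq hlt.ne, fun hgt => absurd hgt hlt.not_gt⟩⟩
  · obtain ⟨C, hC, hsum⟩ := FPP.exists_tsum_influence_rpow_le_of_eq hd hG heq
    exact ⟨C, hC, fun v hv =>
      ⟨fun hlt => absurd heq hlt.ne, fun _ => hsum v hv, fun hgt => absurd heq hgt.ne'⟩⟩
  · obtain ⟨C, hC, hsum⟩ := FPP.exists_tsum_influence_rpow_le_of_gt hd hG hgt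
    exact ⟨C, hC, fun v hv =>
      ⟨fun hlt => absurd hgt hlt.not_gt, fun heq => absurd heq hgt.ne', fun _ => hsum v hv⟩⟩

theorem corollary1p3 (d : ℕ) (hd : 2 ≤ d) (G : Measure ℝ) [IsProbabilityMeasure G]
    (hG : FPP.IsAdmissibleWeight G) :
    (∀ β : ℝ, 1 ≤ β → ∃ C : ℝ, 0 < C ∧ ∀ v : Fin d → ℤ, 2 ≤ FPP.norm2 v →
      (β < 2 * d / (d - 1) →
        ∑' e : FPP.Edge d, FPP.influence G v e ^ β ≤
          ENNReal.ofReal (C *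
            (FPP.norm2 v ^ (((d - 1) / (d + 1)) * (2 * d / (d - 1) - β) : ℝ) *
              Real.log (FPP.norm2 v) ^ ((β - 1) * d : ℝ)))) ∧
      (β = 2 * d / (d - 1) →
        ∑' e : FPP.Edge d, FPP.influence G v e ^ β ≤
          ENNReal.ofReal (C * Real.log (FPP.norm2 v) ^ (d * (d + 1) / (d - 1) + 1 : ℝ))) ∧
      (2 * d / (d - 1) < β →
        ∑' e : FPP.Edge d, FPP.influence G v e ^ β ≤
          ENNReal.ofReal (C * Real.log (FPP.norm2 v) ^ (d * (d + 1) / (d - 1) : ℝ)))) ∧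
    (∃ C : ℝ, 0 < C ∧ ∀ v : Fin d → ℤ, 2 ≤ FPP.norm2 v →
      ∑' e : FPP.Edge d, FPP.influence G v e ^ (2 : ℝ) ≤
        ENNReal.ofReal (C * (FPP.norm2 v ^ (2 / (d + 1) : ℝ) * Real.log (FPP.norm2 v) ^ (d : ℝ)))) := by
  obtain ⟨a, b, α, hcomponent⟩ := hG.exists_hasUniformComponent
  have := hG.nullSingletonClass
  exact corollary1p3_general d hd G hcomponent
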